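/- Let $D\in C^2([0,1];\mathbb{R})$ satisfy $D(0)=0$, $D(u)>0$ for $u\in(0,1]$ and $D'(u)>0$ for $u\in[0,1]$. Let $\alpha\in(0,1)$ and let $f\in C^2([0,1];\mathbb{R})$ be of bistable type: $f(0)=f(\alpha)=f(1)=0$, $f'(0)<0$, $f'(1)<0$, $f'(\alpha)>0$, $f<0$ on $(0,\alpha)$ and $f>0$ on $(\alpha,1)$. Assume $\int_0^1 D(u)f(u)\,du=0$. Let $\varphi:\mathbb{R}\to\mathbb{R}$ be a stationary front of $u_t=(D(u)u_x)_x+f(u)$ connecting $1$ with $0$, that is, a non-increasing differentiable function such that $D(\varphi)\varphi_x$ is differentiable, $$(D(\varphi)\varphi_x)_x+f(\varphi)=0\quad\text{on }\mathbb{R},\qquad \lim_{x\to-\infty}\varphi(x)=1,\qquad \lim_{x\to+\infty}\varphi(x)=0 .$$ Let $\mathcal{L}$ be the linearized operator in the complex space $L^2(\mathbb{R})$, $$\mathcal{L}u=(D(\varphi)u)_{xx}+f'(\varphi)u,\qquad \mathcal{D}(\mathcal{L})=\{u\in L^2(\mathbb{R}) : D(\varphi)u\in H^2(\mathbb{R})\},$$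 and let $\sigma_{\mathrm{pt}}(\mathcal{L})=\{\lambda\in\mathbb{C} : \mathcal{L}-\lambda\text{ is not injective}\}$. Then the point spectrum of $\mathcal{L}$ is real and stable: there exists $\mu_0>0$ such that $$\sigma_{\mathrm{pt}}(\mathcal{L})\subset(-\infty,-\mu_0]\cup\{0\}.$$ Moreover, $\lambda=0$ is a simple eigenvalue of $\mathcal{L}$, that is, its geometric multiplicity $\dim\ker\mathcal{L}$ and its algebraic multiplicity $\dim\bigcup_{n\ge1}\ker\mathcal{L}^n$ are both equal to one, and $\varphi_x\in\mathcal{D}(\mathcal{L})$ is an associated eigenfunction: $\varphi_x\neq0$ and $\mathcal{L}\varphi_x=0$. -/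

import Mathlib

open MeasureTheory Filter Topology Set
open scoped ContDiff

/-- The complex Hilbert space `L²(ℝ)` (Lebesgue measure). -/
abbrev L2 : Type := Lp ℂ 2 (volume : Measure ℝ)

/-! ### The equation and its stationary front -/

/-- The degenerate diffusivities: `D ∈ C²([0,1])`, `D(0) = 0`, `D > 0` on `(0,1]`, `D' > 0` on
`[0,1]` (one-sided derivatives at the end points). -/
structure IsDegenerateDiffusivity (D : ℝ → ℝ) : Prop where
  contDiffOn : ContDiffOn ℝ 2 D (Icc 0 1)
  map_zero : D 0 = 0
  pos : ∀ u ∈ Ioc (0 : ℝ) 1, 0 < D u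
  deriv_pos : ∀ u ∈ Icc (0 : ℝ) 1, 0 < derivWithin D (Icc 0 1) u

/-- The reaction terms of bistable (Nagumo) type with intermediate zero `α`. -/
structure IsBistable (f : ℝ → ℝ) (α : ℝ) : Prop where
  mem_Ioo : α ∈ Ioo (0 : ℝ) 1
  contDiffOn : ContDiffOn ℝ 2 f (Icc 0 1)
  map_zero : f 0 = 0
  map_alpha : f α = 0
  map_one : f 1 = 0
  deriv_zero_neg : derivWithin f (Icc 0 1) 0 < 0
  deriv_one_neg : derivWithin f (Icc 0 1) 1 < 0
  deriv_alpha_pos : 0 < derivWithin f (Icc 0 1) α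
  pos : ∀ u ∈ Ioo α 1, 0 < f u
  neg : ∀ u ∈ Ioo 0 α, f u < 0

/-- `φ` is a monotone stationary front of `u_t = (D(u) u_x)_x + f(u)` which connects `u = 1` (at
`-∞`) with the degenerate state `u = 0` (at `+∞`): a solution of
`(D(φ) φ_x)_x + f(φ) = 0` on the whole line with these limits. -/
structure IsStationaryFront (D f φ : ℝ → ℝ) : Prop where
  differentiable : Differentiable ℝ φ
  profile_eq : ∀ x, HasDerivAt (fun y => D (φ y) * deriv φ y) (-f (φ x)) x
  antitone : Antitone φ
  tendsto_atBot : Tendsto φ atBot (𝓝 1)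
  tendsto_atTop : Tendsto φ atTop (𝓝 0)

theorem IsStationaryFront.mem_Icc {D f φ : ℝ → ℝ} (hφ : IsStationaryFront D f φ) (x : ℝ) :
    φ x ∈ Icc (0 : ℝ) 1 :=
  ⟨hφ.antitone.le_of_tendsto hφ.tendsto_atTop x, hφ.antitone.ge_of_tendsto hφ.tendsto_atBot x⟩

/-! ### Weak derivatives and `H²(ℝ)` -/

/-- `v` is the weak derivative of `w` (both locally integrable) on `ℝ`. -/
def IsWeakDeriv (w v : ℝ → ℂ) : Prop :=
  ∀ η : ℝ → ℝ, ContDiff ℝ ∞ η → HasCompactSupport η →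
    ∫ x, deriv η x • w x = -∫ x, η x • v x

/-- `w ∈ H²(ℝ)` and its second weak derivative is `v`. -/
def IsH2WithSecondDeriv (w v : ℝ → ℂ) : Prop :=
  MemLp w 2 volume ∧ MemLp v 2 volume ∧
    ∃ w₁ : ℝ → ℂ, MemLp w₁ 2 volume ∧ IsWeakDeriv w w₁ ∧ IsWeakDeriv w₁ v

/-- `w ∈ H²(ℝ)`: `w` and its first two weak derivatives are square integrable. -/
def MemH2 (w : ℝ → ℂ) : Prop := ∃ v, IsH2WithSecondDeriv w v

section WeakDerivLemmas

variable {w w' v v' : ℝ → ℂ}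

theorem integrable_test_smul {η : ℝ → ℝ} (hη : Continuous η) (hc : HasCompactSupport η)
    (hw : MemLp w 2 volume) : Integrable (fun x => η x • w x) :=
  (hw.locallyIntegrable (by norm_num)).integrable_smul_left_of_hasCompactSupport hη hc

theorem IsWeakDeriv.congr (h : IsWeakDeriv w v) (hw : w =ᵐ[volume] w') (hv : v =ᵐ[volume] v') :
    IsWeakDeriv w' v' := by
  intro η h1 h2
  have := h η h1 h2
  rw [integral_congr_ae (g := fun x => deriv η x • w' x)
      (by filter_upwards [hw] with x hx using by simp [hx]),
    integral_congr_ae (f := fun x => η x • v x) (g := fun x => η x • v' x)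
      (by filter_upwards [hv] with x hx using by simp [hx])] at this
  exact this

theorem IsWeakDeriv.add (h : IsWeakDeriv w v) (h' : IsWeakDeriv w' v')
    (hw : MemLp w 2 volume) (hv : MemLp v 2 volume)
    (hw' : MemLp w' 2 volume) (hv' : MemLp v' 2 volume) :
    IsWeakDeriv (w + w') (v + v') := by
  intro η h1 h2
  have hd : Continuous (deriv η) := h1.continuous_deriv (by simp)
  have hdc : HasCompactSupport (deriv η) := h2.deriv
  simp only [Pi.add_apply, smul_add]
  rw [integral_add (integrable_test_smul hd hdc hw) (integrable_test_smul hd hdc hw'),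
    integral_add (integrable_test_smul h1.continuous h2 hv)
      (integrable_test_smul h1.continuous h2 hv'), h η h1 h2, h' η h1 h2]
  ring

theorem IsWeakDeriv.const_smul (c : ℂ) (h : IsWeakDeriv w v) :
    IsWeakDeriv (c • w) (c • v) := by
  intro η h1 h2
  have := h η h1 h2
  simp only [Pi.smul_apply, smul_comm _ c, integral_smul, this, smul_neg]

theorem IsWeakDeriv.unique (h : IsWeakDeriv w v) (h' : IsWeakDeriv w v')
    (hv : MemLp v 2 volume) (hv' : MemLp v' 2 volume) : v =ᵐ[volume] v' := by
  refine ae_eq_of_integral_contDiff_smul_eq (hv.locallyIntegrable (by norm_num))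
    (hv'.locallyIntegrable (by norm_num)) fun η h1 h2 => ?_
  exact neg_injective ((h η h1 h2).symm.trans (h' η h1 h2))

theorem IsH2WithSecondDeriv.congr (h : IsH2WithSecondDeriv w v) (hw : w =ᵐ[volume] w')
    (hv : v =ᵐ[volume] v') : IsH2WithSecondDeriv w' v' := by
  obtain ⟨a, b, w₁, c, d, e⟩ := h
  exact ⟨(memLp_congr_ae hw).1 a, (memLp_congr_ae hv).1 b, w₁, c, d.congr hw .rfl,
    e.congr .rfl hv⟩

theorem IsH2WithSecondDeriv.add (h : IsH2WithSecondDeriv w v) (h' : IsH2WithSecondDeriv w' v') :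
    IsH2WithSecondDeriv (w + w') (v + v') := by
  obtain ⟨a, b, w₁, c, d, e⟩ := h
  obtain ⟨a', b', w₁', c', d', e'⟩ := h'
  exact ⟨a.add a', b.add b', w₁ + w₁', c.add c', d.add d' a c a' c', e.add e' c b c' b'⟩

theorem IsH2WithSecondDeriv.const_smul (k : ℂ) (h : IsH2WithSecondDeriv w v) :
    IsH2WithSecondDeriv (k • w) (k • v) := by
  obtain ⟨a, b, w₁, c, d, e⟩ := h
  exact ⟨a.const_smul k, b.const_smul k, k • w₁, c.const_smul k, d.const_smul k, e.const_smul k⟩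

theorem IsH2WithSecondDeriv.unique (h : IsH2WithSecondDeriv w v)
    (h' : IsH2WithSecondDeriv w v') : v =ᵐ[volume] v' := by
  obtain ⟨_, b, w₁, c, d, e⟩ := h
  obtain ⟨_, b', w₁', c', d', e'⟩ := h'
  exact e.unique (e'.congr (d'.unique d c' c) .rfl) b b'

theorem isH2WithSecondDeriv_zero : IsH2WithSecondDeriv 0 0 :=
  ⟨MemLp.zero', MemLp.zero', 0, MemLp.zero', fun _ _ _ => by simp, fun _ _ _ => by simp⟩

end WeakDerivLemmas

/-! ### The linearized operator -/

/-- The function `x ↦ D(φ(x)) u(x)`. -/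
def diffMul (D φ : ℝ → ℝ) (u : ℝ → ℂ) : ℝ → ℂ := fun x => (D (φ x) : ℂ) * u x

/-- The function `x ↦ f'(φ(x)) u(x)`. -/
noncomputable def reactMul (f φ : ℝ → ℝ) (u : ℝ → ℂ) : ℝ → ℂ :=
  fun x => ((derivWithin f (Icc 0 1) (φ x) : ℝ) : ℂ) * u x

theorem diffMul_add_ae (D φ : ℝ → ℝ) (u v : L2) :
    diffMul D φ u + diffMul D φ v =ᵐ[volume] diffMul D φ ⇑(u + v) := by
  filter_upwards [Lp.coeFn_add u v] with x hx
  simp only [diffMul, Pi.add_apply, hx, mul_add]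

theorem diffMul_smul_ae (D φ : ℝ → ℝ) (c : ℂ) (u : L2) :
    c • diffMul D φ u =ᵐ[volume] diffMul D φ ⇑(c • u) := by
  filter_upwards [Lp.coeFn_smul c u] with x hx
  simp only [diffMul, Pi.smul_apply, smul_eq_mul, hx, mul_left_comm]

/-- The domain `{u ∈ L²(ℝ) : D(φ) u ∈ H²(ℝ)}`. -/
def linDomain (D φ : ℝ → ℝ) : Submodule ℂ L2 where
  carrier := {u | MemH2 (diffMul D φ u)}
  add_mem' := by
    rintro u v ⟨a, ha⟩ ⟨b, hb⟩
    exact ⟨a + b, (ha.add hb).congr (diffMul_add_ae D φ u v) .rfl⟩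
  zero_mem' := ⟨0, isH2WithSecondDeriv_zero.congr (by
    filter_upwards [Lp.coeFn_zero ℂ 2 (volume : Measure ℝ)] with x hx
    simp only [diffMul, hx, Pi.zero_apply, mul_zero]) .rfl⟩
  smul_mem' := by
    rintro c u ⟨a, ha⟩
    exact ⟨c • a, (ha.const_smul c).congr (diffMul_smul_ae D φ c u) .rfl⟩

theorem memLp_reactMul {D f φ : ℝ → ℝ} {α : ℝ} (hf : IsBistable f α)
    (hφ : IsStationaryFront D f φ) (u : L2) : MemLp (reactMul f φ u) 2 volume := by
  have hc : ContinuousOn (derivWithin f (Icc 0 1)) (Icc 0 1) :=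
    hf.contDiffOn.continuousOn_derivWithin (uniqueDiffOn_Icc zero_lt_one) (by norm_num)
  obtain ⟨C, hC⟩ := isCompact_Icc.exists_bound_of_continuousOn hc
  have hcont : Continuous fun x => derivWithin f (Icc 0 1) (φ x) :=
    hc.comp_continuous hφ.differentiable.continuous hφ.mem_Icc
  refine MemLp.of_le_mul (c := C) (Lp.memLp u)
    ((Complex.continuous_ofReal.comp hcont).aestronglyMeasurable.mul
      (Lp.aestronglyMeasurable u)) (ae_of_all _ fun x => ?_)
  simp only [reactMul, norm_mul, Complex.norm_real]
  exact mul_le_mul_of_nonneg_right (hC _ (hφ.mem_Icc x)) (norm_nonneg _)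

/-- The second weak derivative `(D(φ) u)_xx` of an element `u` of the domain. -/
noncomputable def linSecondDeriv {D φ : ℝ → ℝ} (u : linDomain D φ) : ℝ → ℂ :=
  Classical.choose (show MemH2 (diffMul D φ u.1) from u.2)

theorem linSecondDeriv_spec {D φ : ℝ → ℝ} (u : linDomain D φ) :
    IsH2WithSecondDeriv (diffMul D φ u.1) (linSecondDeriv u) :=
  Classical.choose_spec (show MemH2 (diffMul D φ u.1) from u.2)

theorem memLp_linSecondDeriv {D φ : ℝ → ℝ} (u : linDomain D φ) :
    MemLp (linSecondDeriv u) 2 volume :=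
  (linSecondDeriv_spec u).2.1

theorem linSecondDeriv_eq {D φ : ℝ → ℝ} (u : linDomain D φ) {v : ℝ → ℂ}
    (hv : IsH2WithSecondDeriv (diffMul D φ u.1) v) : linSecondDeriv u =ᵐ[volume] v :=
  (linSecondDeriv_spec u).unique hv

/-- The linearization `𝓛 u = (D(φ) u)_xx + f'(φ) u` around the front `φ`, an unbounded operator in
`L²(ℝ)` with domain `{u ∈ L²(ℝ) : D(φ) u ∈ H²(ℝ)}`. The hypotheses are only used to see that
`f'(φ)` is bounded and measurable. -/
noncomputable def linearizedOp {D f φ : ℝ → ℝ} {α : ℝ} (hf : IsBistable f α)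
    (hφ : IsStationaryFront D f φ) : L2 →ₗ.[ℂ] L2 where
  domain := linDomain D φ
  toFun :=
    { toFun := fun u => (memLp_linSecondDeriv u).toLp + (memLp_reactMul hf hφ u.1).toLp
      map_add' := by
        intro u v
        rw [add_add_add_comm,
          ← MemLp.toLp_add (memLp_linSecondDeriv u) (memLp_linSecondDeriv v),
          ← MemLp.toLp_add (memLp_reactMul hf hφ u.1) (memLp_reactMul hf hφ v.1)]
        refine congrArg₂ (fun a b : L2 => a + b) ?_ ?_
        · rw [MemLp.toLp_eq_toLp_iff]
          exact linSecondDeriv_eq _ (((linSecondDeriv_spec u).add (linSecondDeriv_spec v)).congr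
            (diffMul_add_ae D φ u.1 v.1) .rfl)
        · rw [MemLp.toLp_eq_toLp_iff]
          filter_upwards [Lp.coeFn_add u.1 v.1] with x hx
          simp only [reactMul, Pi.add_apply, Submodule.coe_add, hx, mul_add]
      map_smul' := by
        intro c u
        rw [RingHom.id_apply, smul_add, ← MemLp.toLp_const_smul, ← MemLp.toLp_const_smul]
        refine congrArg₂ (fun a b : L2 => a + b) ?_ ?_
        · rw [MemLp.toLp_eq_toLp_iff]
          exact linSecondDeriv_eq _ (((linSecondDeriv_spec u).const_smul c).congr
            (diffMul_smul_ae D φ c u.1) .rfl)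
        · rw [MemLp.toLp_eq_toLp_iff]
          filter_upwards [Lp.coeFn_smul c u.1] with x hx
          simp only [reactMul, Pi.smul_apply, Submodule.coe_smul, smul_eq_mul, hx,
            mul_left_comm] }

theorem linearizedOp_eq_iff {D f φ : ℝ → ℝ} {α : ℝ} (hf : IsBistable f α)
    (hφ : IsStationaryFront D f φ) (u : (linearizedOp hf hφ).domain) (v : L2) :
    linearizedOp hf hφ u = v ↔
      IsH2WithSecondDeriv (diffMul D φ u.1) (⇑v - reactMul f φ u.1) := by
  have key : linearizedOp hf hφ u =
      (memLp_linSecondDeriv u).toLp + (memLp_reactMul hf hφ u.1).toLp := rfl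
  have h1 := Lp.coeFn_add ((memLp_linSecondDeriv u).toLp) ((memLp_reactMul hf hφ u.1).toLp)
  have h2 := (memLp_linSecondDeriv u).coeFn_toLp
  have h3 := (memLp_reactMul hf hφ u.1).coeFn_toLp
  rw [key]
  constructor
  · rintro rfl
    refine (linSecondDeriv_spec u).congr .rfl ?_
    filter_upwards [h1, h2, h3] with x h1 h2 h3
    rw [Pi.sub_apply, h1, Pi.add_apply, h2, h3]
    ring
  · intro h
    apply Lp.ext
    filter_upwards [h1, h2, h3, linSecondDeriv_eq u h] with x h1 h2 h3 h4
    rw [h1, Pi.add_apply, h2, h3, h4, Pi.sub_apply]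
    ring

/-! ### Eigenvalues of unbounded operators -/

section Eigen

variable {E : Type*} [AddCommGroup E] [Module ℂ E]

/-- The map `T - z` on the domain of `T`. -/
def shiftedMap (T : E →ₗ.[ℂ] E) (z : ℂ) : T.domain →ₗ[ℂ] E :=
  T.toFun - z • T.domain.subtype

/-- The point spectrum: the `z` for which `T - z` is not injective. -/
def pointSpectrum (T : E →ₗ.[ℂ] E) : Set ℂ :=
  {z | ¬ Function.Injective (shiftedMap T z)}

/-- `ker (T - z)ⁿ`, where the powers have their natural domains: `u ∈ ker (T - z)ⁿ⁺¹` if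
`u` is in the domain of `T` and `(T - z) u ∈ ker (T - z)ⁿ`. -/
def kerPow (T : E →ₗ.[ℂ] E) (z : ℂ) : ℕ → Submodule ℂ E
  | 0 => ⊥
  | n + 1 => ((kerPow T z n).comap (shiftedMap T z)).map T.domain.subtype

/-- The eigenspace `ker (T - z)`. -/
def eigenspaceAt (T : E →ₗ.[ℂ] E) (z : ℂ) : Submodule ℂ E :=
  (LinearMap.ker (shiftedMap T z)).map T.domain.subtype

/-- The generalized eigenspace `⋃ₙ ker (T - z)ⁿ` (an increasing union), that is, all elements of
Jordan chains at `z`. -/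
def genEigenspaceAt (T : E →ₗ.[ℂ] E) (z : ℂ) : Submodule ℂ E :=
  ⨆ n, kerPow T z n

/-- `z` is a simple eigenvalue: geometric and algebraic multiplicity are both one. -/
def IsSimpleEigenvalue (T : E →ₗ.[ℂ] E) (z : ℂ) : Prop :=
  z ∈ pointSpectrum T ∧ Module.finrank ℂ (eigenspaceAt T z) = 1 ∧
    Module.finrank ℂ (genEigenspaceAt T z) = 1

end Eigen

/-!
The flux `p = D(φ) φ_x` satisfies `p² = G(φ)` with `G(s) = -2 ∫₀ˢ D f`, and `G` vanishes to third
order at `0`. Hence `(√φ)_x` is bounded away from zero as `φ → 0`, so the front reaches zero at a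
finite edge `x₀`. To the right of `x₀` the equation `𝓛 u = z u` reduces to `(f'(0) - z) u = 0`; to
the left, `W = D(φ) u` solves a linear second-order equation and vanishes at both ends.

For `𝓛 u = z u + c φ_x` the Wronskian `ω = p W' - p' W` satisfies `(W / p)' = ω / p²` and
`ω' = φ_x (z W + c p)`, and it vanishes at both ends.
* Integrating `(conj (W / p) ω)' = |ω|² / p² + z |W|² / D(φ)` with `c = 0` forces `z` to be real
  and nonpositive.
* For `z = 0`, integrating `ω'` gives `c ∫ φ_x p = 0` with `φ_x p > 0`. So `c = 0`: there are no
  Jordan chains, and `W / p` is constant.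
* For small `z ≠ 0` and `c = 0`, `|ω| ≤ 2 |z| ‖W‖_∞ φ (1 - φ)`, which is dominated by
  `p² ((φ - α) / p)'`. Thus `W` differs from a multiple `k p` by `O(|z| ‖W‖_∞)`, and `k` is of the
  same order because `∫ φ_x W = 0`. Therefore `‖W‖_∞ ≤ M |z| ‖W‖_∞` and `W = 0` once `M |z| < 1`.
-/

/-! ### Weak derivatives on the line -/

section WeakDerivative

theorem intervalIntegrable_of_locallyIntegrable {E : Type*} [NormedAddCommGroup E] {v : ℝ → E}
    (hv : LocallyIntegrable v volume) (a b : ℝ) : IntervalIntegrable v volume a b :=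
  intervalIntegrable_iff.2 <|
    (hv.integrableOn_isCompact isCompact_uIcc).mono_set uIoc_subset_uIcc

theorem exists_tsupport_subset_Ioo {E : Type*} [Zero E] {η : ℝ → E} (hη : HasCompactSupport η) :
    ∃ R : ℝ, 0 < R ∧ tsupport η ⊆ Ioo (-R) R := by
  obtain ⟨r, hr, hsub⟩ := hη.isCompact.isBounded.subset_ball_lt 0 0
  exact ⟨r, hr, by simpa only [Real.ball_eq_Ioo, zero_sub, zero_add] using hsub⟩

theorem continuous_primitive_of_locallyIntegrable {E : Type*} [NormedAddCommGroup E]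
    [NormedSpace ℝ E] {v : ℝ → E} (hv : LocallyIntegrable v volume) :
    Continuous fun x => ∫ t in (0 : ℝ)..x, v t :=
  intervalIntegral.continuous_primitive (intervalIntegrable_of_locallyIntegrable hv) 0

theorem integral_deriv_mul_primitive {g η : ℝ → ℝ} (hg : LocallyIntegrable g volume)
    (hη : ContDiff ℝ 1 η) (hηc : HasCompactSupport η) :
    ∫ x, deriv η x * (∫ t in (0 : ℝ)..x, g t) = -∫ x, η x * g x := by
  obtain ⟨R, hR, hsupp⟩ := exists_tsupport_subset_Ioo hηc
  have integral_eq : ∀ h : ℝ → ℝ, Function.support h ⊆ tsupport η →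
      ∫ x in (-R)..R, h x = ∫ x, h x := fun h hh =>
    intervalIntegral.integral_eq_integral_of_support_subset
      ((hh.trans hsupp).trans Ioo_subset_Ioc_self)
  have hη_left : η (-R) = 0 := image_eq_zero_of_notMem_tsupport fun h => lt_irrefl _ (hsupp h).1
  have hη_right : η R = 0 := image_eq_zero_of_notMem_tsupport fun h => lt_irrefl _ (hsupp h).2
  have hprim : AbsolutelyContinuousOnInterval (fun x => ∫ t in (0 : ℝ)..x, g t) (-R) R :=
    (intervalIntegrable_of_locallyIntegrable hg _ _).absolutelyContinuousOnInterval_intervalIntegral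
      (by rw [uIcc_of_le (neg_lt_self hR).le]; exact ⟨(neg_lt_zero.2 hR).le, hR.le⟩)
  have hηac : AbsolutelyContinuousOnInterval η (-R) R :=
    hη.contDiffOn.absolutelyContinuousOnInterval
  rw [← integral_eq _ ((Function.support_mul_subset_left _ _).trans support_deriv_subset),
    ← integral_eq _ ((Function.support_mul_subset_left _ _).trans (subset_tsupport η))]
  calc ∫ x in (-R)..R, deriv η x * ∫ t in (0 : ℝ)..x, g t
      = ∫ x in (-R)..R, (∫ t in (0 : ℝ)..x, g t) * deriv η x := by simp_rw [mul_comm]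
    _ = -∫ x in (-R)..R, deriv (fun y => ∫ t in (0 : ℝ)..y, g t) x * η x := by
      rw [hprim.integral_mul_deriv_eq_deriv_mul hηac, hη_left, hη_right, mul_zero, mul_zero,
        sub_zero, zero_sub]
    _ = -∫ x in (-R)..R, η x * g x := by
      congr 1
      refine intervalIntegral.integral_congr_ae ?_
      filter_upwards [_root_.LocallyIntegrable.ae_hasDerivAt_integral hg] with x hx _
      rw [(hx 0).deriv, mul_comm]

theorem isWeakDeriv_primitive {v : ℝ → ℂ} (hv : LocallyIntegrable v volume) :
    IsWeakDeriv (fun x => ∫ t in (0 : ℝ)..x, v t) v := by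
  intro η hη hηc
  have hint_prim : Integrable fun x => deriv η x • ∫ t in (0 : ℝ)..x, v t :=
    (continuous_primitive_of_locallyIntegrable
      hv).locallyIntegrable.integrable_smul_left_of_hasCompactSupport
        (hη.continuous_deriv (by simp)) hηc.deriv
  have hint : Integrable fun x => η x • v x :=
    hv.integrable_smul_left_of_hasCompactSupport hη.continuous hηc
  have real_part : ∀ L : ℂ →L[ℝ] ℝ, L (∫ x, deriv η x • ∫ t in (0 : ℝ)..x, v t) =
      L (-∫ x, η x • v x) := by
    intro L
    have hLv : LocallyIntegrable (fun x => L (v x)) volume := fun x =>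
      let ⟨s, hs, hi⟩ := hv x
      ⟨s, hs, L.integrable_comp hi⟩
    rw [map_neg, ← L.integral_comp_comm hint_prim, ← L.integral_comp_comm hint]
    simp only [map_smul, smul_eq_mul,
      ← L.intervalIntegral_comp_comm (intervalIntegrable_of_locallyIntegrable hv _ _)]
    exact integral_deriv_mul_primitive hLv (hη.of_le (by simp)) hηc
  exact Complex.ext (real_part Complex.reCLM) (real_part Complex.imCLM)

theorem exists_deriv_eq_of_integral_eq_zero {η : ℝ → ℝ} (hη : ContDiff ℝ ∞ η)
    (hηc : HasCompactSupport η) (h0 : ∫ x, η x = 0) :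
    ∃ ζ : ℝ → ℝ, ContDiff ℝ ∞ ζ ∧ HasCompactSupport ζ ∧ deriv ζ = η := by
  obtain ⟨R, -, hsupp⟩ := exists_tsupport_subset_Ioo hηc
  have hζ : ∀ x, HasDerivAt (fun x => ∫ t in (-R)..x, η t) (η x) x := fun x =>
    (hη.continuous.integral_hasStrictDerivAt (-R) x).hasDerivAt
  have hderiv : deriv (fun x => ∫ t in (-R)..x, η t) = η := funext fun x => (hζ x).deriv
  refine ⟨_, contDiff_infty_iff_deriv.2 ⟨fun x => (hζ x).differentiableAt, hderiv.symm ▸ hη⟩,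
    HasCompactSupport.intro (isCompact_Icc (a := -R) (b := R)) fun x hx => ?_, hderiv⟩
  rcases lt_or_ge x (-R) with hleft | hleft
  · refine intervalIntegral.integral_zero_ae (ae_of_all _ fun t ht =>
      image_eq_zero_of_notMem_tsupport fun hts => ?_)
    rw [uIoc_of_ge hleft.le] at ht
    exact ht.2.not_gt (hsupp hts).1
  · have hright : R < x := not_le.1 fun h => hx ⟨hleft, h⟩
    rw [← h0]
    refine intervalIntegral.integral_eq_integral_of_support_subset fun t ht => ?_
    have hts := hsupp (subset_tsupport η ht)
    exact ⟨hts.1, hts.2.le.trans hright.le⟩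

theorem IsWeakDeriv.ae_eq_const {w : ℝ → ℂ} (h : IsWeakDeriv w 0)
    (hw : LocallyIntegrable w volume) : ∃ c : ℂ, w =ᵐ[volume] fun _ => c := by
  let bump : ContDiffBump (0 : ℝ) := ⟨1, 2, one_pos, one_lt_two⟩
  set ψ : ℝ → ℝ := bump.normed volume
  have hψ : ContDiff ℝ ∞ ψ := bump.contDiff_normed
  have hψc : HasCompactSupport ψ := bump.hasCompactSupport_normed
  refine ⟨∫ x, ψ x • w x, ae_eq_of_integral_contDiff_smul_eq hw
    (locallyIntegrable_const _) fun η hη hηc => ?_⟩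
  set c : ℝ := ∫ x, η x with hc
  -- `η - (∫ η) ψ` has vanishing integral, hence is the derivative of a test function
  obtain ⟨ζ, hζ, hζc, hζ'⟩ := exists_deriv_eq_of_integral_eq_zero (η := fun x => η x - c * ψ x)
    (hη.sub (contDiff_const.mul hψ)) (hηc.sub (hψc.mul_left (f := fun _ => c)))
    (by rw [integral_sub (hη.continuous.integrable_of_hasCompactSupport hηc)
          ((hψ.continuous.integrable_of_hasCompactSupport hψc).const_mul c), integral_const_mul,
          bump.integral_normed, mul_one, hc, sub_self])
  have hζw := h ζ hζ hζc
  simp only [hζ', sub_smul, mul_smul, Pi.zero_apply, smul_zero, integral_zero, neg_zero] at hζw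
  rw [integral_sub (g := fun x => c • ψ x • w x)
    (hw.integrable_smul_left_of_hasCompactSupport hη.continuous hηc)
    ((hw.integrable_smul_left_of_hasCompactSupport hψ.continuous hψc).smul c), integral_smul,
    sub_eq_zero] at hζw
  rw [hζw, integral_smul_const]

theorem IsWeakDeriv.exists_ae_eq_primitive {w v : ℝ → ℂ} (h : IsWeakDeriv w v)
    (hw : LocallyIntegrable w volume) (hv : LocallyIntegrable v volume) :
    ∃ c : ℂ, w =ᵐ[volume] fun x => c + ∫ t in (0 : ℝ)..x, v t := by
  have hprim := (continuous_primitive_of_locallyIntegrable hv).locallyIntegrable (μ := volume)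
  have hdiff : IsWeakDeriv (w - fun x => ∫ t in (0 : ℝ)..x, v t) 0 := by
    intro η hη hηc
    have hη' : Continuous (deriv η) := hη.continuous_deriv (by simp)
    simp only [Pi.sub_apply, smul_sub, Pi.zero_apply, smul_zero, integral_zero, neg_zero]
    rw [integral_sub (hw.integrable_smul_left_of_hasCompactSupport hη' hηc.deriv)
      (hprim.integrable_smul_left_of_hasCompactSupport hη' hηc.deriv), h η hη hηc,
      isWeakDeriv_primitive hv η hη hηc, sub_self]
  obtain ⟨c, hc⟩ := hdiff.ae_eq_const (hw.sub hprim)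
  exact ⟨c, hc.mono fun x hx => sub_eq_iff_eq_add.1 hx⟩

theorem IsH2WithSecondDeriv.exists_representative {w v : ℝ → ℂ} (h : IsH2WithSecondDeriv w v) :
    ∃ (W W₁ : ℝ → ℂ) (c : ℂ), w =ᵐ[volume] W ∧ (∀ x, HasDerivAt W (W₁ x) x) ∧
      (∀ x, W₁ x = c + ∫ t in (0 : ℝ)..x, v t) ∧ MemLp W 2 volume ∧ MemLp W₁ 2 volume := by
  obtain ⟨hw, hv, w₁, hw₁, hww₁, hw₁v⟩ := h
  have hvloc := hv.locallyIntegrable (by norm_num)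
  obtain ⟨c, hc⟩ := hw₁v.exists_ae_eq_primitive (hw₁.locallyIntegrable (by norm_num)) hvloc
  have hcont : Continuous fun x => c + ∫ t in (0 : ℝ)..x, v t :=
    continuous_const.add (continuous_primitive_of_locallyIntegrable hvloc)
  obtain ⟨k, hk⟩ := (hww₁.congr .rfl hc).exists_ae_eq_primitive
    (hw.locallyIntegrable (by norm_num)) hcont.locallyIntegrable
  exact ⟨_, _, c, hk, fun x => (hcont.integral_hasStrictDerivAt 0 x).hasDerivAt.const_add k,
    fun _ => rfl, (memLp_congr_ae hk).1 hw, (memLp_congr_ae hc).1 hw₁⟩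

theorem IsWeakDeriv.of_hasDerivAt {w v : ℝ → ℂ} (hwv : ∀ x, HasDerivAt w (v x) x)
    (hv : LocallyIntegrable v volume) : IsWeakDeriv w v := by
  intro η hη hηc
  have hw : LocallyIntegrable w volume :=
    (continuous_iff_continuousAt.2 fun x => (hwv x).continuousAt).locallyIntegrable
  have hparts := integral_bilinear_hasDerivAt_right_eq_neg_left_of_integrable
    (L := ContinuousLinearMap.lsmul ℝ ℝ (E := ℂ)) (u := η) (u' := deriv η) (v := w) (v' := v)
    (fun x _ => (hη.differentiable (by simp) x).hasDerivAt) (fun x _ => hwv x)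
    (hv.integrable_smul_left_of_hasCompactSupport hη.continuous hηc)
    (hw.integrable_smul_left_of_hasCompactSupport (hη.continuous_deriv (by simp)) hηc.deriv)
    (hw.integrable_smul_left_of_hasCompactSupport hη.continuous hηc)
  simp only [ContinuousLinearMap.lsmul_apply] at hparts
  rw [hparts, neg_neg]

end WeakDerivative

/-! ### Endpoint asymptotics of the nonlinearities -/

section OneSidedLimits

theorem exists_bound_of_tendsto_endpoints {a b la lb : ℝ} {h : ℝ → ℝ}
    (hh : ContinuousOn h (Ioo a b)) (ha : Tendsto h (𝓝[>] a) (𝓝 la))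
    (hb : Tendsto h (𝓝[<] b) (𝓝 lb)) : ∃ C : ℝ, 0 < C ∧ ∀ s ∈ Ioo a b, |h s| ≤ C := by
  obtain ⟨C, hC⟩ := isCompact_Icc.exists_bound_of_continuousOn
    (continuousOn_Icc_extendFrom_Ioo hh ha hb)
  refine ⟨max C 1, by positivity, fun s hs => (le_max_left C 1).trans' ?_⟩
  simpa only [extendFrom_extends hh s hs, Real.norm_eq_abs] using hC s (Ioo_subset_Icc_self hs)

theorem exists_pos_le_of_tendsto_endpoints {a b la lb : ℝ} {h : ℝ → ℝ} (hab : a < b)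
    (hh : ContinuousOn h (Ioo a b)) (hpos : ∀ s ∈ Ioo a b, 0 < h s)
    (ha : Tendsto h (𝓝[>] a) (𝓝 la)) (hla : 0 < la)
    (hb : Tendsto h (𝓝[<] b) (𝓝 lb)) (hlb : 0 < lb) :
    ∃ c : ℝ, 0 < c ∧ ∀ s ∈ Ioo a b, c ≤ h s := by
  obtain ⟨r, hr, hmin⟩ := isCompact_Icc.exists_isMinOn (nonempty_Icc.2 hab.le)
    (continuousOn_Icc_extendFrom_Ioo hh ha hb)
  refine ⟨extendFrom (Ioo a b) h r, ?_, fun s hs => ?_⟩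
  · rcases hr.1.eq_or_lt with rfl | har
    · rwa [eq_lim_at_left_extendFrom_Ioo hab ha]
    rcases hr.2.eq_or_lt with rfl | hrb
    · rwa [eq_lim_at_right_extendFrom_Ioo hab hb]
    · rw [extendFrom_extends hh r ⟨har, hrb⟩]
      exact hpos r ⟨har, hrb⟩
  · rw [← extendFrom_extends hh s hs]
    exact hmin (Ioo_subset_Icc_self hs)

theorem tendsto_div_sub_nhdsGT {a b : ℝ} {g : ℝ → ℝ} (hab : a < b)
    (hg : DifferentiableWithinAt ℝ g (Icc a b) a) (ha : g a = 0) :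
    Tendsto (fun s => g s / (s - a)) (𝓝[>] a) (𝓝 (derivWithin g (Icc a b) a)) := by
  have hslope := (hasDerivWithinAt_iff_tendsto_slope' left_notMem_Ioo).1
    (hg.hasDerivWithinAt.mono Ioo_subset_Icc_self)
  rw [nhdsWithin_Ioo_eq_nhdsGT hab] at hslope
  simpa only [slope_fun_def_field, ha, sub_zero] using hslope

theorem tendsto_div_sub_nhdsLT {a b : ℝ} {g : ℝ → ℝ} (hab : a < b)
    (hg : DifferentiableWithinAt ℝ g (Icc a b) b) (hb : g b = 0) :
    Tendsto (fun s => g s / (b - s)) (𝓝[<] b) (𝓝 (-derivWithin g (Icc a b) b)) := by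
  have hslope := (hasDerivWithinAt_iff_tendsto_slope' right_notMem_Ioo).1
    (hg.hasDerivWithinAt.mono Ioo_subset_Icc_self)
  rw [nhdsWithin_Ioo_eq_nhdsLT hab] at hslope
  simpa only [slope_fun_def_field, hb, sub_zero, ← div_neg, neg_sub] using hslope.neg

end OneSidedLimits

/-- The hypotheses on the nonlinearities: a degenerate diffusivity and a bistable reaction which
balance each other, so that the front is stationary. -/
structure IsBalancedBistable (D f : ℝ → ℝ) (α : ℝ) : Prop where
  diffusivity : IsDegenerateDiffusivity D
  reaction : IsBistable f α
  integral_eq_zero : ∫ u in (0 : ℝ)..1, D u * f u = 0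

/-- The potential `G(s) = -2 ∫₀ˢ D f` of the first integral `(D(φ) φ_x)² = G(φ)` of the profile
equation. -/
noncomputable def frontPotential (D f : ℝ → ℝ) (s : ℝ) : ℝ :=
  -2 * ∫ t in (0 : ℝ)..s, D t * f t

section Coefficients

variable {D f : ℝ → ℝ} {α s : ℝ}

theorem IsDegenerateDiffusivity.continuousOn (hD : IsDegenerateDiffusivity D) :
    ContinuousOn D (Icc 0 1) :=
  hD.contDiffOn.continuousOn

theorem IsBistable.continuousOn (hf : IsBistable f α) : ContinuousOn f (Icc 0 1) :=
  hf.contDiffOn.continuousOn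

theorem IsBistable.continuousOn_derivWithin (hf : IsBistable f α) :
    ContinuousOn (derivWithin f (Icc 0 1)) (Icc 0 1) :=
  hf.contDiffOn.continuousOn_derivWithin (uniqueDiffOn_Icc zero_lt_one) one_le_two

theorem IsDegenerateDiffusivity.nonneg (hD : IsDegenerateDiffusivity D) (hs : s ∈ Icc (0 : ℝ) 1) :
    0 ≤ D s := by
  rcases hs.1.eq_or_lt with rfl | h
  · exact hD.map_zero.ge
  · exact (hD.pos s ⟨h, hs.2⟩).le

theorem IsDegenerateDiffusivity.tendsto_div_id (hD : IsDegenerateDiffusivity D) :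
    Tendsto (fun s => D s / s) (𝓝[>] 0) (𝓝 (derivWithin D (Icc 0 1) 0)) := by
  simpa only [sub_zero] using tendsto_div_sub_nhdsGT zero_lt_one
    (hD.contDiffOn.differentiableOn two_ne_zero 0 (left_mem_Icc.2 zero_le_one)) hD.map_zero

theorem IsDegenerateDiffusivity.tendsto_one (hD : IsDegenerateDiffusivity D) :
    Tendsto D (𝓝[<] 1) (𝓝 (D 1)) := by
  rw [← nhdsWithin_Ioo_eq_nhdsLT zero_lt_one]
  exact (hD.continuousOn 1 (right_mem_Icc.2 zero_le_one)).mono Ioo_subset_Icc_self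

theorem IsBistable.tendsto_div_id (hf : IsBistable f α) :
    Tendsto (fun s => f s / s) (𝓝[>] 0) (𝓝 (derivWithin f (Icc 0 1) 0)) := by
  simpa only [sub_zero] using tendsto_div_sub_nhdsGT zero_lt_one
    (hf.contDiffOn.differentiableOn two_ne_zero 0 (left_mem_Icc.2 zero_le_one)) hf.map_zero

theorem IsBistable.tendsto_div_one_sub (hf : IsBistable f α) :
    Tendsto (fun s => f s / (1 - s)) (𝓝[<] 1) (𝓝 (-derivWithin f (Icc 0 1) 1)) :=
  tendsto_div_sub_nhdsLT zero_lt_one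
    (hf.contDiffOn.differentiableOn two_ne_zero 1 (right_mem_Icc.2 zero_le_one)) hf.map_one

theorem IsDegenerateDiffusivity.exists_le_mul (hD : IsDegenerateDiffusivity D) :
    ∃ C : ℝ, 0 < C ∧ ∀ s ∈ Ioo (0 : ℝ) 1, D s ≤ C * s := by
  obtain ⟨C, hC, hDC⟩ := exists_bound_of_tendsto_endpoints
    ((hD.continuousOn.mono Ioo_subset_Icc_self).div continuousOn_id fun s hs => hs.1.ne')
    hD.tendsto_div_id (hD.tendsto_one.div nhdsWithin_le_nhds one_ne_zero)
  exact ⟨C, hC, fun s hs => (div_le_iff₀ hs.1).1 ((le_abs_self _).trans (hDC s hs))⟩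

theorem IsDegenerateDiffusivity.exists_mul_le (hD : IsDegenerateDiffusivity D) :
    ∃ c : ℝ, 0 < c ∧ ∀ s ∈ Ioo (0 : ℝ) 1, c * s ≤ D s := by
  obtain ⟨c, hc, hDc⟩ := exists_pos_le_of_tendsto_endpoints zero_lt_one
    ((hD.continuousOn.mono Ioo_subset_Icc_self).div continuousOn_id fun s hs => hs.1.ne')
    (fun s hs => div_pos (hD.pos s (Ioo_subset_Ioc_self hs)) hs.1)
    hD.tendsto_div_id (hD.deriv_pos 0 (left_mem_Icc.2 zero_le_one))
    (hD.tendsto_one.div nhdsWithin_le_nhds one_ne_zero)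
    (div_pos (hD.pos 1 (right_mem_Ioc.2 zero_lt_one)) one_pos)
  exact ⟨c, hc, fun s hs => (le_div_iff₀ hs.1).1 (hDc s hs)⟩

theorem IsBistable.exists_abs_le (hf : IsBistable f α) :
    ∃ C : ℝ, 0 < C ∧ ∀ s ∈ Ioo (0 : ℝ) 1, |f s| ≤ C * (s * (1 - s)) := by
  have hpos : ∀ s ∈ Ioo (0 : ℝ) 1, 0 < s * (1 - s) := fun s hs => mul_pos hs.1 (sub_pos.2 hs.2)
  have hone : Tendsto (fun s : ℝ => 1 - s) (𝓝[>] 0) (𝓝 1) :=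
    tendsto_nhdsWithin_of_tendsto_nhds (Continuous.tendsto' (by fun_prop) 0 1 (sub_zero 1))
  obtain ⟨C, hC, hfC⟩ := exists_bound_of_tendsto_endpoints (h := fun s => f s / (s * (1 - s)))
    ((hf.continuousOn.mono Ioo_subset_Icc_self).div (by fun_prop) fun s hs => (hpos s hs).ne')
    (by simpa only [Pi.div_def, div_div] using hf.tendsto_div_id.div hone one_ne_zero)
    (by simpa only [Pi.div_def, div_div, mul_comm] using
      hf.tendsto_div_one_sub.div (g := fun s => s) nhdsWithin_le_nhds one_ne_zero)
  refine ⟨C, hC, fun s hs => ?_⟩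
  have := hfC s hs
  rwa [abs_div, abs_of_pos (hpos s hs), div_le_iff₀ (hpos s hs)] at this

theorem IsBistable.sub_mul_nonneg (hf : IsBistable f α) (hs : s ∈ Ioo (0 : ℝ) 1) :
    0 ≤ (s - α) * f s := by
  rcases lt_trichotomy s α with h | rfl | h
  · exact mul_nonneg_of_nonpos_of_nonpos (sub_neg.2 h).le (hf.neg s ⟨hs.1, h⟩).le
  · rw [sub_self, zero_mul]
  · exact mul_nonneg (sub_pos.2 h).le (hf.pos s ⟨h, hs.2⟩).le

theorem frontPotential_zero (D f : ℝ → ℝ) : frontPotential D f 0 = 0 := by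
  rw [frontPotential, intervalIntegral.integral_same, mul_zero]

namespace IsBalancedBistable

variable (hN : IsBalancedBistable D f α)

include hN

theorem hasDerivWithinAt_frontPotential (hs : s ∈ Icc (0 : ℝ) 1) :
    HasDerivWithinAt (frontPotential D f) (-2 * (D s * f s)) (Icc 0 1) s := by
  have hDf : ContinuousOn (fun t => D t * f t) (Icc 0 1) :=
    hN.diffusivity.continuousOn.mul hN.reaction.continuousOn
  have : Fact (s ∈ Icc (0 : ℝ) 1) := ⟨hs⟩
  refine (intervalIntegral.integral_hasDerivWithinAt_right ?_ (t := Icc 0 1)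
    (hDf.stronglyMeasurableAtFilter_nhdsWithin measurableSet_Icc s) (hDf s hs)).const_mul (-2)
  exact (hDf.mono (by rw [uIcc_of_le hs.1]; exact Icc_subset_Icc_right hs.2)).intervalIntegrable

theorem hasDerivAt_frontPotential (hs : s ∈ Ioo (0 : ℝ) 1) :
    HasDerivAt (frontPotential D f) (-2 * (D s * f s)) s :=
  (hN.hasDerivWithinAt_frontPotential (Ioo_subset_Icc_self hs)).hasDerivAt
    (Icc_mem_nhds hs.1 hs.2)

theorem continuousOn_frontPotential : ContinuousOn (frontPotential D f) (Icc 0 1) := fun _ hs =>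
  (hN.hasDerivWithinAt_frontPotential hs).continuousWithinAt

theorem frontPotential_one : frontPotential D f 1 = 0 := by
  rw [frontPotential, hN.integral_eq_zero, mul_zero]

theorem frontPotential_pos (hs : s ∈ Ioo (0 : ℝ) 1) : 0 < frontPotential D f s := by
  obtain ⟨hα0, hα1⟩ := hN.reaction.mem_Ioo
  rcases le_total s α with h | h
  · have hmono : StrictMonoOn (frontPotential D f) (Icc 0 α) :=
      strictMonoOn_of_deriv_pos (convex_Icc _ _)
        (hN.continuousOn_frontPotential.mono (Icc_subset_Icc_right hα1.le)) fun t ht => by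
          rw [interior_Icc] at ht
          have ht1 : t < 1 := ht.2.trans hα1
          rw [(hN.hasDerivAt_frontPotential ⟨ht.1, ht1⟩).deriv]
          nlinarith [mul_pos (hN.diffusivity.pos t ⟨ht.1, ht1.le⟩)
            (neg_pos.2 (hN.reaction.neg t ht))]
    rw [← frontPotential_zero D f]
    exact hmono (left_mem_Icc.2 hα0.le) ⟨hs.1.le, h⟩ hs.1
  · have hanti : StrictAntiOn (frontPotential D f) (Icc α 1) :=
      strictAntiOn_of_deriv_neg (convex_Icc _ _)
        (hN.continuousOn_frontPotential.mono (Icc_subset_Icc_left hα0.le)) fun t ht => by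
          rw [interior_Icc] at ht
          have ht0 : 0 < t := hα0.trans ht.1
          rw [(hN.hasDerivAt_frontPotential ⟨ht0, ht.2⟩).deriv]
          nlinarith [mul_pos (hN.diffusivity.pos t ⟨ht0, ht.2.le⟩) (hN.reaction.pos t ht)]
    rw [← hN.frontPotential_one]
    exact hanti ⟨h, hs.2.le⟩ (right_mem_Icc.2 hα1.le) hs.2

theorem tendsto_frontPotential_zero : Tendsto (frontPotential D f) (𝓝[>] 0) (𝓝 0) := by
  have h := (hN.continuousOn_frontPotential 0 (left_mem_Icc.2 zero_le_one)).mono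
    Ioo_subset_Icc_self
  rwa [ContinuousWithinAt, frontPotential_zero, nhdsWithin_Ioo_eq_nhdsGT zero_lt_one] at h

theorem tendsto_frontPotential_one : Tendsto (frontPotential D f) (𝓝[<] 1) (𝓝 0) := by
  have h := (hN.continuousOn_frontPotential 1 (right_mem_Icc.2 zero_le_one)).mono
    Ioo_subset_Icc_self
  rwa [ContinuousWithinAt, hN.frontPotential_one, nhdsWithin_Ioo_eq_nhdsLT zero_lt_one] at h

theorem tendsto_frontPotential_div_cube :
    Tendsto (fun s => frontPotential D f s / s ^ 3) (𝓝[>] 0)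
      (𝓝 (-(2 / 3) * (derivWithin D (Icc 0 1) 0 * derivWithin f (Icc 0 1) 0))) := by
  have hI := Ioo_mem_nhdsGT (zero_lt_one (α := ℝ))
  refine HasDerivAt.lhopital_zero_nhdsGT (f' := fun s => -2 * (D s * f s))
    (g' := fun s : ℝ => 3 * s ^ 2)
    (by filter_upwards [hI] with s hs using hN.hasDerivAt_frontPotential hs)
    (by filter_upwards with s using by simpa using hasDerivAt_pow 3 s)
    (by filter_upwards [hI] with s hs using mul_ne_zero three_ne_zero (pow_ne_zero 2 hs.1.ne'))
    hN.tendsto_frontPotential_zero (tendsto_nhdsWithin_of_tendsto_nhds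
      ((continuous_pow 3).tendsto' 0 0 (by norm_num))) ?_
  refine ((hN.diffusivity.tendsto_div_id.mul hN.reaction.tendsto_div_id).const_mul _).congr' ?_
  filter_upwards [hI] with s hs
  have := hs.1.ne'
  field_simp

theorem tendsto_frontPotential_div_one_sub_sq :
    Tendsto (fun s => frontPotential D f s / (1 - s) ^ 2) (𝓝[<] 1)
      (𝓝 (D 1 * -derivWithin f (Icc 0 1) 1)) := by
  have hI := Ioo_mem_nhdsLT (zero_lt_one (α := ℝ))
  refine HasDerivAt.lhopital_zero_nhdsLT (f' := fun s => -2 * (D s * f s))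
    (g' := fun s : ℝ => -2 * (1 - s))
    (by filter_upwards [hI] with s hs using hN.hasDerivAt_frontPotential hs)
    (by filter_upwards with s using
      by simpa using ((hasDerivAt_id s).const_sub 1).fun_pow 2)
    (by filter_upwards [hI] with s hs using mul_ne_zero (by norm_num) (sub_pos.2 hs.2).ne')
    hN.tendsto_frontPotential_one (tendsto_nhdsWithin_of_tendsto_nhds
      (Continuous.tendsto' (by fun_prop) 1 0 (by norm_num))) ?_
  refine (hN.diffusivity.tendsto_one.mul hN.reaction.tendsto_div_one_sub).congr' ?_
  filter_upwards [hI] with s hs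
  have := (sub_pos.2 hs.2).ne'
  field_simp

theorem tendsto_frontPotential_ratio_zero :
    Tendsto (fun s => frontPotential D f s / D s ^ 2 / (s * (1 - s) ^ 2)) (𝓝[>] 0)
      (𝓝 (-(2 / 3) * (derivWithin D (Icc 0 1) 0 * derivWithin f (Icc 0 1) 0) /
        derivWithin D (Icc 0 1) 0 ^ 2)) := by
  have hD0 := (hN.diffusivity.deriv_pos 0 (left_mem_Icc.2 zero_le_one)).ne'
  have hone : Tendsto (fun s : ℝ => (1 - s) ^ 2) (𝓝[>] 0) (𝓝 1) :=
    tendsto_nhdsWithin_of_tendsto_nhds (Continuous.tendsto' (by fun_prop) 0 1 (by norm_num))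
  have h := (hN.tendsto_frontPotential_div_cube.div (hN.diffusivity.tendsto_div_id.pow 2)
    (pow_ne_zero 2 hD0)).div hone one_ne_zero
  rw [div_one] at h
  refine h.congr' ?_
  filter_upwards [Ioo_mem_nhdsGT (zero_lt_one (α := ℝ))] with s hs
  have := hs.1.ne'
  simp only [Pi.div_apply]
  field_simp

theorem tendsto_frontPotential_ratio_one :
    Tendsto (fun s => frontPotential D f s / D s ^ 2 / (s * (1 - s) ^ 2)) (𝓝[<] 1)
      (𝓝 (D 1 * -derivWithin f (Icc 0 1) 1 / D 1 ^ 2)) := by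
  have hD1 := (hN.diffusivity.pos 1 (right_mem_Ioc.2 zero_lt_one)).ne'
  have h := (hN.tendsto_frontPotential_div_one_sub_sq.div (hN.diffusivity.tendsto_one.pow 2)
    (pow_ne_zero 2 hD1)).div (g := fun s => s) nhdsWithin_le_nhds one_ne_zero
  rw [div_one] at h
  refine h.congr fun s => ?_
  simp only [Pi.div_apply, div_div]
  ring_nf

theorem continuousOn_frontPotential_ratio :
    ContinuousOn (fun s => frontPotential D f s / D s ^ 2 / (s * (1 - s) ^ 2)) (Ioo 0 1) := by
  refine ((hN.continuousOn_frontPotential.mono Ioo_subset_Icc_self).div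
    ((hN.diffusivity.continuousOn.mono Ioo_subset_Icc_self).pow 2) fun s hs => ?_).div
    (by fun_prop) fun s hs => ?_
  · exact pow_ne_zero 2 (hN.diffusivity.pos s (Ioo_subset_Ioc_self hs)).ne'
  · exact (mul_pos hs.1 (pow_pos (sub_pos.2 hs.2) 2)).ne'

theorem exists_frontPotential_div_sq_le : ∃ C : ℝ, 0 < C ∧ ∀ s ∈ Ioo (0 : ℝ) 1,
    frontPotential D f s / D s ^ 2 ≤ C * (s * (1 - s) ^ 2) := by
  obtain ⟨C, hC, hGC⟩ := exists_bound_of_tendsto_endpoints hN.continuousOn_frontPotential_ratio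
    hN.tendsto_frontPotential_ratio_zero hN.tendsto_frontPotential_ratio_one
  exact ⟨C, hC, fun s hs => (div_le_iff₀ (mul_pos hs.1 (pow_pos (sub_pos.2 hs.2) 2))).1
    ((le_abs_self _).trans (hGC s hs))⟩

theorem exists_le_frontPotential_div_sq : ∃ c : ℝ, 0 < c ∧ ∀ s ∈ Ioo (0 : ℝ) 1,
    c * (s * (1 - s) ^ 2) ≤ frontPotential D f s / D s ^ 2 := by
  have hD0 := hN.diffusivity.deriv_pos 0 (left_mem_Icc.2 zero_le_one)
  have hD1 := hN.diffusivity.pos 1 (right_mem_Ioc.2 zero_lt_one)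
  have hf0 := hN.reaction.deriv_zero_neg
  have hf1 := hN.reaction.deriv_one_neg
  have hpos : ∀ s ∈ Ioo (0 : ℝ) 1, 0 < s * (1 - s) ^ 2 := fun s hs =>
    mul_pos hs.1 (pow_pos (sub_pos.2 hs.2) 2)
  obtain ⟨c, hc, hGc⟩ := exists_pos_le_of_tendsto_endpoints zero_lt_one
    hN.continuousOn_frontPotential_ratio
    (fun s hs => div_pos (div_pos (hN.frontPotential_pos hs)
      (pow_pos (hN.diffusivity.pos s (Ioo_subset_Ioc_self hs)) 2)) (hpos s hs))
    hN.tendsto_frontPotential_ratio_zero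
    (div_pos (by nlinarith [mul_pos hD0 (neg_pos.2 hf0)]) (pow_pos hD0 2))
    hN.tendsto_frontPotential_ratio_one
    (div_pos (mul_pos hD1 (neg_pos.2 hf1)) (pow_pos hD1 2))
  exact ⟨c, hc, fun s hs => (le_div_iff₀ (hpos s hs)).1 (hGc s hs)⟩

theorem tendsto_frontPotential_div_add_ratio_zero :
    Tendsto (fun s => (frontPotential D f s / D s + (s - α) * f s) / (s * (1 - s))) (𝓝[>] 0)
      (𝓝 (-α * derivWithin f (Icc 0 1) 0)) := by
  have hD0 := (hN.diffusivity.deriv_pos 0 (left_mem_Icc.2 zero_le_one)).ne'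
  have lim : ∀ {g : ℝ → ℝ} {c : ℝ}, Continuous g → g 0 = c → Tendsto g (𝓝[>] 0) (𝓝 c) :=
    fun hg h0 => tendsto_nhdsWithin_of_tendsto_nhds (hg.tendsto' _ _ h0)
  have h := (((hN.tendsto_frontPotential_div_cube.div hN.diffusivity.tendsto_div_id hD0).mul
    (lim continuous_id rfl)).add
    ((lim (g := fun s => s - α) (by fun_prop) (zero_sub α)).mul hN.reaction.tendsto_div_id)).div
    (lim (g := fun s => 1 - s) (by fun_prop) (sub_zero 1)) one_ne_zero
  rw [id_eq, mul_zero, zero_add, div_one] at h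
  refine h.congr' ?_
  filter_upwards [Ioo_mem_nhdsGT (zero_lt_one (α := ℝ))] with s hs
  have := hs.1.ne'
  simp only [Pi.div_apply, id_eq]
  field_simp

theorem tendsto_frontPotential_div_add_ratio_one :
    Tendsto (fun s => (frontPotential D f s / D s + (s - α) * f s) / (s * (1 - s))) (𝓝[<] 1)
      (𝓝 ((1 - α) * -derivWithin f (Icc 0 1) 1)) := by
  have hD1 := (hN.diffusivity.pos 1 (right_mem_Ioc.2 zero_lt_one)).ne'
  have lim : ∀ {g : ℝ → ℝ} {c : ℝ}, Continuous g → g 1 = c → Tendsto g (𝓝[<] 1) (𝓝 c) :=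
    fun hg h1 => tendsto_nhdsWithin_of_tendsto_nhds (hg.tendsto' _ _ h1)
  have h := (((hN.tendsto_frontPotential_div_one_sub_sq.div hN.diffusivity.tendsto_one hD1).mul
    (lim (g := fun s => 1 - s) (by fun_prop) (sub_self 1))).add
    ((lim (g := fun s => s - α) (by fun_prop) rfl).mul hN.reaction.tendsto_div_one_sub)).div
    (lim continuous_id rfl) one_ne_zero
  rw [mul_zero, zero_add, id_eq, div_one] at h
  refine h.congr' ?_
  filter_upwards [Ioo_mem_nhdsLT (zero_lt_one (α := ℝ))] with s hs
  have := (sub_pos.2 hs.2).ne'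
  simp only [Pi.div_apply, id_eq]
  field_simp

theorem exists_mul_le_frontPotential_div_add : ∃ c : ℝ, 0 < c ∧ ∀ s ∈ Ioo (0 : ℝ) 1,
    c * (s * (1 - s)) ≤ frontPotential D f s / D s + (s - α) * f s := by
  obtain ⟨hα0, hα1⟩ := hN.reaction.mem_Ioo
  have hpos : ∀ s ∈ Ioo (0 : ℝ) 1, 0 < s * (1 - s) := fun s hs => mul_pos hs.1 (sub_pos.2 hs.2)
  have hDpos : ∀ s ∈ Ioo (0 : ℝ) 1, 0 < D s := fun s hs =>
    hN.diffusivity.pos s (Ioo_subset_Ioc_self hs)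
  obtain ⟨c, hc, hle⟩ := exists_pos_le_of_tendsto_endpoints zero_lt_one
    ((((hN.continuousOn_frontPotential.mono Ioo_subset_Icc_self).div
      (hN.diffusivity.continuousOn.mono Ioo_subset_Icc_self) fun s hs => (hDpos s hs).ne').add
      (ContinuousOn.mul (by fun_prop) (hN.reaction.continuousOn.mono Ioo_subset_Icc_self))).div
      (by fun_prop) fun s hs => (hpos s hs).ne')
    (fun s hs => div_pos (add_pos_of_pos_of_nonneg
      (div_pos (hN.frontPotential_pos hs) (hDpos s hs)) (hN.reaction.sub_mul_nonneg hs))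
      (hpos s hs))
    hN.tendsto_frontPotential_div_add_ratio_zero (by nlinarith [hN.reaction.deriv_zero_neg])
    hN.tendsto_frontPotential_div_add_ratio_one
    (mul_pos (sub_pos.2 hα1) (neg_pos.2 hN.reaction.deriv_one_neg))
  exact ⟨c, hc, fun s hs => (le_div_iff₀ (hpos s hs)).1 (hle s hs)⟩

end IsBalancedBistable

end Coefficients

/-! ### The profile equation -/

/-- The flux `p = D(φ) φ_x` of the front. -/
noncomputable def frontFlux (D φ : ℝ → ℝ) (x : ℝ) : ℝ :=
  D (φ x) * deriv φ x

namespace IsStationaryFront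

variable {D f φ : ℝ → ℝ} {α x : ℝ} (hφ : IsStationaryFront D f φ)

include hφ

theorem continuous : Continuous φ :=
  hφ.differentiable.continuous

theorem hasDerivAt (x : ℝ) : HasDerivAt φ (deriv φ x) x :=
  (hφ.differentiable x).hasDerivAt

theorem deriv_nonpos (x : ℝ) : deriv φ x ≤ 0 :=
  hφ.antitone.deriv_nonpos

theorem hasDerivAt_frontFlux (x : ℝ) : HasDerivAt (frontFlux D φ) (-f (φ x)) x :=
  hφ.profile_eq x

theorem continuous_frontFlux : Continuous (frontFlux D φ) :=
  continuous_iff_continuousAt.2 fun x => (hφ.hasDerivAt_frontFlux x).continuousAt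

theorem continuous_comp {g : ℝ → ℝ} (hg : ContinuousOn g (Icc 0 1)) :
    Continuous fun x => g (φ x) :=
  hg.comp_continuous hφ.continuous hφ.mem_Icc

theorem tendsto_comp_atBot {g : ℝ → ℝ} (hg : ContinuousOn g (Icc 0 1)) :
    Tendsto (fun x => g (φ x)) atBot (𝓝 (g 1)) :=
  (hg 1 (right_mem_Icc.2 zero_le_one)).tendsto.comp
    (tendsto_nhdsWithin_iff.2 ⟨hφ.tendsto_atBot, Eventually.of_forall hφ.mem_Icc⟩)

theorem tendsto_comp_atTop {g : ℝ → ℝ} (hg : ContinuousOn g (Icc 0 1)) :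
    Tendsto (fun x => g (φ x)) atTop (𝓝 (g 0)) :=
  (hg 0 (left_mem_Icc.2 zero_le_one)).tendsto.comp
    (tendsto_nhdsWithin_iff.2 ⟨hφ.tendsto_atTop, Eventually.of_forall hφ.mem_Icc⟩)

theorem hasDerivAt_comp {g : ℝ → ℝ} {g' : ℝ} (hg : HasDerivWithinAt g g' (Icc 0 1) (φ x)) :
    HasDerivAt (fun y => g (φ y)) (g' * deriv φ x) x :=
  hasDerivWithinAt_univ.1 <|
    hg.comp x (hφ.hasDerivAt x).hasDerivWithinAt fun y _ => hφ.mem_Icc y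

theorem exists_eq {s : ℝ} (hs : s ∈ Ioo (0 : ℝ) 1) : ∃ x, φ x = s := by
  obtain ⟨a, ha⟩ := (hφ.tendsto_atBot.eventually (lt_mem_nhds hs.2)).exists
  obtain ⟨b, hb⟩ := (hφ.tendsto_atTop.eventually (gt_mem_nhds hs.1)).exists
  exact mem_range_of_exists_le_of_exists_ge hφ.continuous ⟨b, hb.le⟩ ⟨a, ha.le⟩

theorem deriv_eq_zero_of_notMem_Ioo (hx : φ x ∉ Ioo (0 : ℝ) 1) : deriv φ x = 0 := by
  rcases (hφ.mem_Icc x).1.eq_or_lt with h0 | h0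
  · exact IsLocalMin.deriv_eq_zero (Eventually.of_forall fun y => h0 ▸ (hφ.mem_Icc y).1)
  · have h1 : φ x = 1 := (hφ.mem_Icc x).2.antisymm (not_lt.1 fun h1 => hx ⟨h0, h1⟩)
    exact IsLocalMax.deriv_eq_zero (Eventually.of_forall fun y => h1 ▸ (hφ.mem_Icc y).2)

theorem exists_tendsto_deriv_zero :
    ∃ ξ : ℕ → ℝ, Tendsto ξ atTop atTop ∧ Tendsto (fun n => deriv φ (ξ n)) atTop (𝓝 0) := by
  have hmean : ∀ n : ℕ, ∃ ξ ∈ Ioo (n : ℝ) (n + 1), deriv φ ξ = φ (n + 1) - φ n := fun n => by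
    simpa only [add_sub_cancel_left, div_one] using exists_deriv_eq_slope φ (lt_add_one (n : ℝ))
      hφ.continuous.continuousOn hφ.differentiable.differentiableOn
  choose ξ hξ hderiv using hmean
  have hn : Tendsto (fun n : ℕ => (n : ℝ)) atTop atTop := tendsto_natCast_atTop_atTop
  refine ⟨ξ, tendsto_atTop_mono (fun n => (hξ n).1.le) hn, ?_⟩
  simpa only [hderiv, sub_zero, Function.comp_def] using
    (hφ.tendsto_atTop.comp (tendsto_atTop_add_const_right _ 1 hn)).sub
      (hφ.tendsto_atTop.comp hn)

theorem integrable_deriv : Integrable (deriv φ) := by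
  rw [← integrableOn_univ, ← Iic_union_Ioi (a := (0 : ℝ))]
  refine IntegrableOn.union ?_ (integrableOn_Ioi_deriv_of_nonpos' (fun x _ => hφ.hasDerivAt x)
    (fun x _ => hφ.deriv_nonpos x) hφ.tendsto_atTop)
  have hreflect : IntegrableOn (fun x => -deriv φ (-x)) (Ioi (-0)) :=
    integrableOn_Ioi_deriv_of_nonneg' (g := fun x => φ (-x)) (l := 1)
      (fun x _ => ((hφ.hasDerivAt (-x)).comp x (hasDerivAt_neg x)).congr_deriv (mul_neg_one _))
      (fun x _ => neg_nonneg.2 (hφ.deriv_nonpos (-x)))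
      (hφ.tendsto_atBot.comp tendsto_neg_atTop_atBot)
  rw [integrableOn_Iic_iff_integrableOn_Iio]
  simpa only [Pi.neg_def, neg_neg] using hreflect.neg.comp_neg_Iio

section Balanced

variable (hN : IsBalancedBistable D f α)

include hN

theorem frontFlux_sq (x : ℝ) : frontFlux D φ x ^ 2 = frontPotential D f (φ x) := by
  set E : ℝ → ℝ := fun y => frontFlux D φ y ^ 2 - frontPotential D f (φ y) with hE
  have hE' : ∀ y, HasDerivAt E 0 y := fun y =>
    (((hφ.hasDerivAt_frontFlux y).pow 2).sub (hφ.hasDerivAt_comp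
      (hN.hasDerivWithinAt_frontPotential (hφ.mem_Icc y)))).congr_deriv (by
        simp only [frontFlux]
        ring)
  have hconst : ∀ y, E y = E x := fun y =>
    is_const_of_deriv_eq_zero (fun y => (hE' y).differentiableAt) (fun y => (hE' y).deriv) y x
  obtain ⟨ξ, hξ, hderiv⟩ := hφ.exists_tendsto_deriv_zero
  have hlim : Tendsto (fun n => E (ξ n)) atTop (𝓝 0) := by
    have hflux := ((hφ.tendsto_comp_atTop hN.diffusivity.continuousOn).comp hξ).mul hderiv
    have hpot := (hφ.tendsto_comp_atTop hN.continuousOn_frontPotential).comp hξ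
    simpa [hE, frontFlux, frontPotential_zero] using (hflux.pow 2).sub hpot
  have hEx : E x = 0 :=
    tendsto_nhds_unique (tendsto_const_nhds.congr fun n => (hconst (ξ n)).symm) hlim
  exact sub_eq_zero.1 hEx

theorem deriv_sq (hx : φ x ∈ Ioo (0 : ℝ) 1) :
    deriv φ x ^ 2 = frontPotential D f (φ x) / D (φ x) ^ 2 := by
  have hDx := (hN.diffusivity.pos _ (Ioo_subset_Ioc_self hx)).ne'
  rw [eq_div_iff (pow_ne_zero 2 hDx), ← hφ.frontFlux_sq hN, frontFlux, mul_pow, mul_comm]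

theorem exists_abs_deriv_le :
    ∃ C : ℝ, 0 < C ∧ ∀ x, |deriv φ x| ≤ C * (√(φ x) * (1 - φ x)) := by
  obtain ⟨C, hC, hGC⟩ := hN.exists_frontPotential_div_sq_le
  refine ⟨√C, Real.sqrt_pos.2 hC, fun x => ?_⟩
  obtain ⟨h0, h1⟩ := hφ.mem_Icc x
  have := sub_nonneg.2 h1
  by_cases hx : φ x ∈ Ioo (0 : ℝ) 1
  · refine abs_le_of_sq_le_sq ?_ (by positivity)
    rw [hφ.deriv_sq hN hx, mul_pow, mul_pow, Real.sq_sqrt hC.le, Real.sq_sqrt h0]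
    exact hGC _ hx
  · rw [hφ.deriv_eq_zero_of_notMem_Ioo hx, abs_zero]
    positivity

theorem exists_le_abs_deriv :
    ∃ c : ℝ, 0 < c ∧ ∀ x, c * (√(φ x) * (1 - φ x)) ≤ |deriv φ x| := by
  obtain ⟨c, hc, hcG⟩ := hN.exists_le_frontPotential_div_sq
  refine ⟨√c, Real.sqrt_pos.2 hc, fun x => ?_⟩
  obtain ⟨h0, h1⟩ := hφ.mem_Icc x
  by_cases hx : φ x ∈ Ioo (0 : ℝ) 1
  · refine (le_abs_self _).trans (sq_le_sq.1 ?_)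
    rw [hφ.deriv_sq hN hx, mul_pow, mul_pow, Real.sq_sqrt hc.le, Real.sq_sqrt h0]
    exact hcG _ hx
  · have hzero : √(φ x) * (1 - φ x) = 0 := by
      rcases h0.eq_or_lt with h | h
      · rw [← h, Real.sqrt_zero, zero_mul]
      · rw [h1.antisymm (not_lt.1 fun h' => hx ⟨h, h'⟩), sub_self, mul_zero]
    rw [hzero, mul_zero]
    exact abs_nonneg _

theorem exists_abs_deriv_le_const : ∃ C : ℝ, 0 < C ∧ ∀ x, |deriv φ x| ≤ C := by
  obtain ⟨C, hC, hle⟩ := hφ.exists_abs_deriv_le hN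
  refine ⟨C, hC, fun x => (hle x).trans (mul_le_of_le_one_right hC.le ?_)⟩
  obtain ⟨h0, h1⟩ := hφ.mem_Icc x
  exact mul_le_one₀ (Real.sqrt_le_one.2 h1) (sub_nonneg.2 h1) (sub_le_self _ h0)

theorem lt_one (x : ℝ) : φ x < 1 := by
  refine (hφ.mem_Icc x).2.lt_of_ne fun hx => ?_
  obtain ⟨C, hC, hle⟩ := hφ.exists_abs_deriv_le hN
  have hode : ∀ t, ‖-deriv φ t‖ ≤ C * ‖1 - φ t‖ := fun t => by
    have h1 := (hφ.mem_Icc t).2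
    have h1' := sub_nonneg.2 h1
    rw [norm_neg, Real.norm_eq_abs, Real.norm_of_nonneg h1']
    refine (hle t).trans (mul_le_mul_of_nonneg_left ?_ hC.le)
    exact mul_le_of_le_one_left h1' (Real.sqrt_le_one.2 h1)
  have hone : ∀ y, x ≤ y → 1 - φ y = 0 := fun y hy =>
    eq_zero_of_abs_deriv_le_mul_abs_self_of_eq_zero_right (f := fun t => 1 - φ t)
      (continuous_const.sub hφ.continuous).continuousOn
      (fun t _ => ((hφ.hasDerivAt t).const_sub 1).hasDerivWithinAt)
      (sub_eq_zero.2 hx.symm) (fun t _ => hode t) y (right_mem_Icc.2 hy)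
  have hlim := tendsto_nhds_unique (tendsto_const_nhds.congr' ((eventually_ge_atTop x).mono
    fun y hy => (sub_eq_zero.1 (hone y hy)))) hφ.tendsto_atTop
  exact one_ne_zero hlim

theorem mem_Ioo (hx : 0 < φ x) : φ x ∈ Ioo (0 : ℝ) 1 :=
  ⟨hx, hφ.lt_one hN x⟩

theorem deriv_neg (hx : 0 < φ x) : deriv φ x < 0 := by
  obtain ⟨c, hc, hle⟩ := hφ.exists_le_abs_deriv hN
  have hpos : 0 < c * (√(φ x) * (1 - φ x)) :=
    mul_pos hc (mul_pos (Real.sqrt_pos.2 hx) (sub_pos.2 (hφ.lt_one hN x)))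
  exact (hφ.deriv_nonpos x).lt_of_ne (abs_pos.1 (hpos.trans_le (hle x)))

theorem frontFlux_neg (hx : 0 < φ x) : frontFlux D φ x < 0 :=
  mul_neg_of_pos_of_neg (hN.diffusivity.pos _ (Ioo_subset_Ioc_self (hφ.mem_Ioo hN hx)))
    (hφ.deriv_neg hN hx)

theorem tendsto_frontFlux_atBot : Tendsto (frontFlux D φ) atBot (𝓝 0) := by
  have h := (hφ.tendsto_comp_atBot hN.continuousOn_frontPotential).sqrt
  rw [hN.frontPotential_one, Real.sqrt_zero] at h
  refine squeeze_zero_norm (fun x => ?_) h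
  rw [← hφ.frontFlux_sq hN, Real.sqrt_sq_eq_abs, Real.norm_eq_abs]

-- `(√φ)' = φ' / (2 √φ)` stays below a negative constant while `φ` is positive and at most `1 / 2`.
theorem exists_mul_sub_le_sqrt : ∃ c : ℝ, 0 < c ∧ ∀ a b, a ≤ b → φ a ≤ 1 / 2 →
    (∀ t ∈ Ioo a b, 0 < φ t) → c * (b - a) ≤ √(φ a) := by
  obtain ⟨c, hc, hle⟩ := hφ.exists_le_abs_deriv hN
  refine ⟨c / 4, by positivity, fun a b hab ha hpos => ?_⟩
  have hanti : AntitoneOn (fun t => √(φ t) + c / 4 * t) (Icc a b) := by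
    refine antitoneOn_of_hasDerivWithinAt_nonpos (convex_Icc a b)
      (f' := fun t => deriv φ t / (2 * √(φ t)) + c / 4 * 1)
      (by have := hφ.continuous; fun_prop)
      (fun t ht => ?_) fun t ht => ?_ <;> rw [interior_Icc] at ht
    · exact (((hφ.hasDerivAt t).sqrt (hpos t ht).ne').add
        ((hasDerivAt_id t).const_mul _)).hasDerivWithinAt
    · have hsqrt := Real.sqrt_pos.2 (hpos t ht)
      have hhalf : 1 / 2 ≤ 1 - φ t := by linarith [hφ.antitone ht.1.le]
      have hderiv := hle t
      rw [abs_of_nonpos (hφ.deriv_nonpos t)] at hderiv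
      have hslope : deriv φ t / (2 * √(φ t)) ≤ -(c / 4) := by
        rw [div_le_iff₀ (by positivity)]
        nlinarith [mul_le_mul_of_nonneg_left hhalf (mul_pos hc hsqrt).le]
      linarith
  have := hanti (left_mem_Icc.2 hab) (right_mem_Icc.2 hab) hab
  linarith [Real.sqrt_nonneg (φ b)]

theorem exists_eq_zero : ∃ x, φ x = 0 := by
  by_contra! hne
  obtain ⟨c, hc, hle⟩ := hφ.exists_mul_sub_le_sqrt hN
  obtain ⟨a, ha⟩ := hφ.exists_eq (s := 1 / 2) ⟨by norm_num, by norm_num⟩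
  have hlong := hle a (a + 2 / c) (le_add_of_nonneg_right (by positivity)) ha.le
    fun t _ => (hφ.mem_Icc t).1.lt_of_ne' (hne t)
  rw [add_sub_cancel_left, mul_div_cancel₀ _ hc.ne'] at hlong
  linarith [Real.sqrt_le_one.2 (hφ.mem_Icc a).2]

theorem exists_edge : ∃ x₀, ∀ x, 0 < φ x ↔ x < x₀ := by
  set Z := {x | φ x = 0}
  have hbdd : BddBelow Z := by
    obtain ⟨b, hb⟩ := hφ.exists_eq (s := 1 / 2) ⟨by norm_num, by norm_num⟩
    refine ⟨b, fun x hx => not_lt.1 fun hxb => ?_⟩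
    have := hφ.antitone hxb.le
    rw [hb, show φ x = 0 from hx] at this
    norm_num at this
  have hmem : φ (sInf Z) = 0 :=
    (isClosed_eq hφ.continuous continuous_const).csInf_mem (hφ.exists_eq_zero hN) hbdd
  refine ⟨sInf Z, fun x => ⟨fun hx => not_le.1 fun h => ?_, fun hx => ?_⟩⟩
  · exact hx.not_ge (hmem ▸ hφ.antitone h)
  · exact (hφ.mem_Icc x).1.lt_of_ne' fun h => (csInf_le hbdd h).not_gt hx

theorem exists_abs_reaction_le : ∃ C : ℝ, 0 < C ∧ ∀ x, |f (φ x)| ≤ C * (√(φ x) * |deriv φ x|) := by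
  obtain ⟨C, hC, hfC⟩ := hN.reaction.exists_abs_le
  obtain ⟨c, hc, hle⟩ := hφ.exists_le_abs_deriv hN
  refine ⟨C / c, by positivity, fun x => ?_⟩
  rcases (hφ.mem_Icc x).1.eq_or_lt with h0 | h0
  · rw [← h0, hN.reaction.map_zero, abs_zero]
    positivity
  · have hderiv : √(φ x) * (1 - φ x) ≤ |deriv φ x| / c := by
      rw [le_div_iff₀' hc]
      exact hle x
    calc |f (φ x)| ≤ C * (φ x * (1 - φ x)) := hfC _ (hφ.mem_Ioo hN h0)
      _ = C * (√(φ x) * (√(φ x) * (1 - φ x))) := by rw [← mul_assoc √_, Real.mul_self_sqrt h0.le]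
      _ ≤ C * (√(φ x) * (|deriv φ x| / c)) := by gcongr
      _ = C / c * (√(φ x) * |deriv φ x|) := by ring

theorem exists_sqrt_mul_abs_reaction_le :
    ∃ C : ℝ, 0 < C ∧ ∀ x, √(φ x) * |f (φ x)| ≤ C * |frontFlux D φ x| := by
  obtain ⟨C, hC, hfC⟩ := hφ.exists_abs_reaction_le hN
  obtain ⟨d, hd, hdD⟩ := hN.diffusivity.exists_mul_le
  refine ⟨C / d, by positivity, fun x => ?_⟩
  rcases (hφ.mem_Icc x).1.eq_or_lt with h0 | h0
  · rw [← h0, Real.sqrt_zero, zero_mul]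
    positivity
  · have hφD : φ x ≤ D (φ x) / d := (le_div_iff₀' hd).2 (hdD _ (hφ.mem_Ioo hN h0))
    calc √(φ x) * |f (φ x)| ≤ √(φ x) * (C * (√(φ x) * |deriv φ x|)) := by gcongr; exact hfC x
      _ = C * (√(φ x) * √(φ x) * |deriv φ x|) := by ring
      _ ≤ C * (D (φ x) / d * |deriv φ x|) := by
        rw [Real.mul_self_sqrt h0.le]
        gcongr
      _ = C / d * |frontFlux D φ x| := by
        rw [frontFlux, abs_mul, abs_of_nonneg (hN.diffusivity.nonneg (hφ.mem_Icc x))]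
        ring

theorem memLp_deriv : MemLp (fun x => ((deriv φ x : ℝ) : ℂ)) 2 volume := by
  obtain ⟨C, -, hle⟩ := hφ.exists_abs_deriv_le_const hN
  have hmeas : AEStronglyMeasurable (fun x => ((deriv φ x : ℝ) : ℂ)) volume :=
    (Complex.measurable_ofReal.comp (measurable_deriv φ)).aestronglyMeasurable
  rw [memLp_two_iff_integrable_sq_norm hmeas]
  refine (hφ.integrable_deriv.norm.const_mul C).mono' (hmeas.norm.pow 2) (ae_of_all _ fun x => ?_)
  simp only [Complex.norm_real, Real.norm_eq_abs, abs_pow, abs_abs]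
  rw [sq]
  exact mul_le_mul_of_nonneg_right (hle x) (abs_nonneg _)

end Balanced

end IsStationaryFront

/-! ### The equation to the left of the edge -/

section HalfLine

variable {x₀ x y : ℝ}

theorem norm_sub_le_sub_of_norm_deriv_le {q q' : ℝ → ℂ} {g g' : ℝ → ℝ}
    (hq : ∀ x < x₀, HasDerivAt q (q' x) x) (hg : ∀ x < x₀, HasDerivAt g (g' x) x)
    (hle : ∀ x < x₀, ‖q' x‖ ≤ g' x) (hxy : x ≤ y) (hy : y < x₀) :
    ‖q y - q x‖ ≤ g y - g x := by
  have hlt : ∀ t ∈ Icc x y, t < x₀ := fun t ht => ht.2.trans_lt hy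
  refine image_norm_le_of_norm_deriv_right_le_deriv_boundary' (f := fun t => q t - q x)
    (f' := q') (B := fun t => g t - g x) (B' := g') (a := x) (b := y)
    (fun t ht => (hq t (hlt t ht)).continuousAt.continuousWithinAt.sub continuousWithinAt_const)
    (fun t ht => ((hq t (hlt t ⟨ht.1, ht.2.le⟩)).sub_const _).hasDerivWithinAt) (by simp)
    (fun t ht => (hg t (hlt t ht)).continuousAt.continuousWithinAt.sub continuousWithinAt_const)
    (fun t ht => ((hg t (hlt t ⟨ht.1, ht.2.le⟩)).sub_const _).hasDerivWithinAt)
    (fun t ht => hle t (hlt t ⟨ht.1, ht.2.le⟩)) (right_mem_Icc.2 hxy)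

theorem eq_of_deriv_eq_zero_of_lt {q : ℝ → ℂ} (hq : ∀ x < x₀, HasDerivAt q 0 x) (hx : x < x₀)
    (hy : y < x₀) : q x = q y := by
  have h : ∀ s t, s ≤ t → t < x₀ → q t = q s := fun s t hst ht =>
    sub_eq_zero.1 <| norm_le_zero_iff.1 <|
      (norm_sub_le_sub_of_norm_deriv_le (g := fun _ => 0) (g' := fun _ => 0) hq
        (fun t _ => hasDerivAt_const t 0) (fun _ _ => norm_zero.le) hst ht).trans (sub_self _).le
  exact (le_total x y).elim (fun hxy => (h x y hxy hy).symm) fun hyx => h y x hyx hx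

theorem deriv_eq_zero_of_nonneg_of_tendsto {g g' : ℝ → ℝ}
    (hg : ∀ x < x₀, HasDerivAt g (g' x) x) (hnonneg : ∀ x < x₀, 0 ≤ g' x)
    (hbot : Tendsto g atBot (𝓝 0)) (hedge : Tendsto g (𝓝[<] x₀) (𝓝 0)) (hx : x < x₀) :
    g' x = 0 := by
  have hmono : MonotoneOn g (Iio x₀) :=
    monotoneOn_of_hasDerivWithinAt_nonneg (f' := g') (convex_Iio x₀)
      (fun t ht => (hg t ht).continuousAt.continuousWithinAt)
      (fun t ht => (hg t (by rwa [interior_Iio] at ht)).hasDerivWithinAt)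
      (fun t ht => hnonneg t (by rwa [interior_Iio] at ht))
  have hzero : ∀ y < x₀, g y = 0 := fun y hy => le_antisymm
    (ge_of_tendsto hedge <| eventually_of_mem (Ioo_mem_nhdsLT hy) fun t ht =>
      hmono hy ht.2 ht.1.le)
    (le_of_tendsto hbot ((eventually_le_atBot y).mono fun t ht => hmono (ht.trans_lt hy) hy ht))
  exact (hg x hx).unique ((hasDerivAt_const x (0 : ℝ)).congr_of_eventuallyEq
    (eventually_of_mem (Iio_mem_nhds hx) hzero))

theorem re_deriv_eq_zero_of_nonneg_of_tendsto {F F' : ℝ → ℂ}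
    (hF : ∀ x < x₀, HasDerivAt F (F' x) x) (hnonneg : ∀ x < x₀, 0 ≤ (F' x).re)
    (hbot : Tendsto F atBot (𝓝 0)) (hedge : Tendsto F (𝓝[<] x₀) (𝓝 0)) (hx : x < x₀) :
    (F' x).re = 0 :=
  deriv_eq_zero_of_nonneg_of_tendsto (g := fun y => (F y).re)
    (fun y hy => Complex.reCLM.hasFDerivAt.comp_hasDerivAt y (hF y hy)) hnonneg
    ((Complex.continuous_re.tendsto 0).comp hbot) ((Complex.continuous_re.tendsto 0).comp hedge) hx

end HalfLine

/-- `φ` is a stationary front for the balanced nonlinearities `D`, `f`, and its support is the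
half-line to the left of the edge `x₀`. -/
structure IsSharpFront (D f φ : ℝ → ℝ) (α x₀ : ℝ) : Prop where
  balanced : IsBalancedBistable D f α
  stationary : IsStationaryFront D f φ
  pos_iff : ∀ x, 0 < φ x ↔ x < x₀

namespace IsSharpFront

variable {D f φ : ℝ → ℝ} {α x₀ x : ℝ} (hS : IsSharpFront D f φ α x₀)

include hS

theorem eq_zero (hx : x₀ ≤ x) : φ x = 0 :=
  (hS.stationary.mem_Icc x).1.antisymm' (not_lt.1 fun h => ((hS.pos_iff x).1 h).not_ge hx)

theorem mem_Ioo (hx : x < x₀) : φ x ∈ Ioo (0 : ℝ) 1 :=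
  hS.stationary.mem_Ioo hS.balanced ((hS.pos_iff x).2 hx)

theorem diffusivity_pos (hx : x < x₀) : 0 < D (φ x) :=
  hS.balanced.diffusivity.pos _ (Ioo_subset_Ioc_self (hS.mem_Ioo hx))

theorem frontFlux_neg (hx : x < x₀) : frontFlux D φ x < 0 :=
  hS.stationary.frontFlux_neg hS.balanced ((hS.pos_iff x).2 hx)

theorem deriv_eq_zero (hx : x₀ ≤ x) : deriv φ x = 0 :=
  hS.stationary.deriv_eq_zero_of_notMem_Ioo fun h => h.1.ne' (hS.eq_zero hx)

theorem frontFlux_edge : frontFlux D φ x₀ = 0 := by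
  rw [frontFlux, hS.deriv_eq_zero le_rfl, mul_zero]

theorem exists_abs_frontFlux_le : ∃ C : ℝ, 0 < C ∧ ∀ x < x₀, |frontFlux D φ x| ≤ C := by
  obtain ⟨C, hC, hderiv⟩ := hS.stationary.exists_abs_deriv_le_const hS.balanced
  obtain ⟨M, hM, hDM⟩ := hS.balanced.diffusivity.exists_le_mul
  refine ⟨M * C, by positivity, fun x hx => ?_⟩
  obtain ⟨h0, h1⟩ := hS.mem_Ioo hx
  rw [frontFlux, abs_mul, abs_of_pos (hS.diffusivity_pos hx)]
  have hD : D (φ x) ≤ M := (hDM _ ⟨h0, h1⟩).trans (mul_le_of_le_one_right hM.le h1.le)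
  gcongr
  exact hderiv x

theorem exists_mul_min_le_sqrt :
    ∃ c : ℝ, 0 < c ∧ ∀ x ≤ x₀, c * min 1 (x₀ - x) ≤ √(φ x) := by
  obtain ⟨c, hc, hle⟩ := hS.stationary.exists_mul_sub_le_sqrt hS.balanced
  refine ⟨min c (1 / 2), by positivity, fun x hx => ?_⟩
  have := sub_nonneg.2 hx
  rcases le_total (φ x) (1 / 2) with h | h
  · calc min c (1 / 2) * min 1 (x₀ - x) ≤ c * (x₀ - x) :=
          mul_le_mul (min_le_left _ _) (min_le_right _ _) (by positivity) hc.le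
      _ ≤ √(φ x) := hle x x₀ hx h fun t ht => (hS.pos_iff t).2 ht.2
  · calc min c (1 / 2) * min 1 (x₀ - x) ≤ 1 / 2 * 1 :=
          mul_le_mul (min_le_right _ _) (min_le_left _ _) (by positivity) (by norm_num)
      _ ≤ √(φ x) := Real.le_sqrt_of_sq_le (by linarith)

theorem integrable_deriv_mul_frontFlux : Integrable fun x => deriv φ x * frontFlux D φ x := by
  obtain ⟨C, hC, hle⟩ := hS.exists_abs_frontFlux_le
  refine hS.stationary.integrable_deriv.mul_bdd (c := C)
    hS.stationary.continuous_frontFlux.aestronglyMeasurable (ae_of_all _ fun x => ?_)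
  rcases lt_or_ge x x₀ with hx | hx
  · exact hle x hx
  · rw [frontFlux, hS.deriv_eq_zero hx, mul_zero, norm_zero]
    exact hC.le

theorem integral_deriv_mul_frontFlux_pos : 0 < ∫ x in Iic x₀, deriv φ x * frontFlux D φ x := by
  have hpos : ∀ x < x₀, 0 < deriv φ x * frontFlux D φ x := fun x hx =>
    mul_pos_of_neg_of_neg (hS.stationary.deriv_neg hS.balanced ((hS.pos_iff x).2 hx))
      (hS.frontFlux_neg hx)
  have hsupp : Iio x₀ ⊆ Function.support fun x => deriv φ x * frontFlux D φ x :=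
    fun x hx => (hpos x hx).ne'
  rw [integral_Iic_eq_integral_Iio, setIntegral_pos_iff_support_of_nonneg_ae
    ((ae_restrict_mem measurableSet_Iio).mono fun x hx => (hpos x hx).le)
    hS.integrable_deriv_mul_frontFlux.integrableOn,
    inter_eq_right.2 hsupp, Real.volume_Iio]
  exact ENNReal.zero_lt_top

theorem hasDerivAt_sub_div_frontFlux (hx : x < x₀) :
    HasDerivAt (fun y => (φ y - α) / frontFlux D φ y)
      ((frontPotential D f (φ x) / D (φ x) + (φ x - α) * f (φ x)) / frontFlux D φ x ^ 2) x := by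
  refine (((hS.stationary.hasDerivAt x).sub_const α).div (hS.stationary.hasDerivAt_frontFlux x)
    (hS.frontFlux_neg hx).ne).congr_deriv ?_
  have hD := (hS.diffusivity_pos hx).ne'
  rw [← hS.stationary.frontFlux_sq hS.balanced, frontFlux]
  field_simp
  ring

end IsSharpFront

/-- `W` solves `W'' + f'(φ) W / D(φ) = z W / D(φ) + c φ_x` to the left of the edge `x₀` of the
front, vanishes at both ends, and has a bounded derivative. With `W = D(φ) u` this is the equation
`𝓛 u = z u + c φ_x` on the support of the front. -/
structure IsEdgeSolution (D f φ : ℝ → ℝ) (x₀ : ℝ) (z c : ℂ) (W : ℝ → ℂ) : Prop where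
  differentiable : Differentiable ℝ W
  hasDerivAt_deriv : ∀ x < x₀, HasDerivAt (deriv W)
    ((z - (derivWithin f (Icc 0 1) (φ x) : ℝ)) * (W x / (D (φ x) : ℝ)) + c * (deriv φ x : ℝ)) x
  edge : W x₀ = 0
  tendsto_atBot : Tendsto W atBot (𝓝 0)
  bounded : ∃ K, ∀ x ≤ x₀, ‖W x‖ ≤ K ∧ ‖deriv W x‖ ≤ K

/-- The Wronskian `p W' - p' W` of the flux `p` of the front and `W`, where `p' = -f(φ)`. -/
noncomputable def fluxWronskian (D f φ : ℝ → ℝ) (W : ℝ → ℂ) (x : ℝ) : ℂ :=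
  (frontFlux D φ x : ℂ) * deriv W x + (f (φ x) : ℂ) * W x

/-- The boundary term `conj (W / p) (p W' - p' W)` of the Dirichlet form of the equation in the
variable `W / p`. -/
noncomputable def boundaryForm (D f φ : ℝ → ℝ) (W : ℝ → ℂ) (x : ℝ) : ℂ :=
  starRingEnd ℂ (W x / (frontFlux D φ x : ℂ)) * fluxWronskian D f φ W x

namespace IsEdgeSolution

variable {D f φ : ℝ → ℝ} {α x₀ x : ℝ} {z c : ℂ} {W : ℝ → ℂ}
  (h : IsEdgeSolution D f φ x₀ z c W) (hS : IsSharpFront D f φ α x₀)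

include h

theorem hasDerivAt (x : ℝ) : HasDerivAt W (deriv W x) x :=
  (h.differentiable x).hasDerivAt

include hS

theorem hasDerivAt_fluxWronskian (hx : x < x₀) :
    HasDerivAt (fluxWronskian D f φ W)
      (((deriv φ x : ℝ) : ℂ) * (z * W x + c * (frontFlux D φ x : ℂ))) x := by
  have hD : (D (φ x) : ℂ) ≠ 0 := Complex.ofReal_ne_zero.2 (hS.diffusivity_pos hx).ne'
  have hf := (hS.balanced.reaction.contDiffOn.differentiableOn two_ne_zero _
    (hS.stationary.mem_Icc x)).hasDerivWithinAt
  refine (((hS.stationary.hasDerivAt_frontFlux x).ofReal_comp.mul (h.hasDerivAt_deriv x hx)).add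
    ((hS.stationary.hasDerivAt_comp hf).ofReal_comp.mul (h.hasDerivAt x))).congr_deriv ?_
  simp only [frontFlux]
  push_cast
  field_simp
  ring

theorem exists_norm_le_mul_sqrt : ∃ K, 0 ≤ K ∧ ∀ x ≤ x₀, ‖W x‖ ≤ K * √(φ x) := by
  obtain ⟨K, hK⟩ := h.bounded
  obtain ⟨c, hc, hle⟩ := hS.exists_mul_min_le_sqrt
  have hK0 : 0 ≤ K := (norm_nonneg _).trans (hK x₀ le_rfl).1
  refine ⟨K / c, by positivity, fun x hx => ?_⟩
  have hlip : ‖W x‖ ≤ K * (x₀ - x) := by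
    have := (convex_Icc x x₀).norm_image_sub_le_of_norm_hasDerivWithin_le
      (fun t _ => (h.hasDerivAt t).hasDerivWithinAt) (fun t ht => (hK t ht.2).2)
      (left_mem_Icc.2 hx) (right_mem_Icc.2 hx)
    rwa [h.edge, zero_sub, norm_neg, Real.norm_of_nonneg (sub_nonneg.2 hx)] at this
  calc ‖W x‖ ≤ K * min 1 (x₀ - x) := by
        rw [mul_min_of_nonneg _ _ hK0, mul_one]
        exact le_min (hK x hx).1 hlip
    _ ≤ K * (√(φ x) / c) := by
        gcongr
        exact (le_div_iff₀' hc).2 (hle x hx)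
    _ = K / c * √(φ x) := by ring

theorem exists_norm_fluxWronskian_le :
    ∃ K, ∀ x ≤ x₀, ‖fluxWronskian D f φ W x‖ ≤ K * |frontFlux D φ x| := by
  obtain ⟨K, hK⟩ := h.bounded
  obtain ⟨L, hL, hWL⟩ := h.exists_norm_le_mul_sqrt hS
  obtain ⟨C, -, hfC⟩ := hS.stationary.exists_sqrt_mul_abs_reaction_le hS.balanced
  refine ⟨K + L * C, fun x hx => ?_⟩
  calc ‖fluxWronskian D f φ W x‖
      ≤ |frontFlux D φ x| * ‖deriv W x‖ + |f (φ x)| * ‖W x‖ := by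
        refine (norm_add_le _ _).trans_eq ?_
        simp only [norm_mul, Complex.norm_real, Real.norm_eq_abs]
    _ ≤ |frontFlux D φ x| * K + |f (φ x)| * (L * √(φ x)) := by
        gcongr
        exacts [(hK x hx).2, hWL x hx]
    _ = K * |frontFlux D φ x| + L * (√(φ x) * |f (φ x)|) := by ring
    _ ≤ K * |frontFlux D φ x| + L * (C * |frontFlux D φ x|) := by
        gcongr K * |frontFlux D φ x| + L * ?_
        exact hfC x
    _ = (K + L * C) * |frontFlux D φ x| := by ring

theorem tendsto_fluxWronskian_atBot : Tendsto (fluxWronskian D f φ W) atBot (𝓝 0) := by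
  obtain ⟨K, hK⟩ := h.exists_norm_fluxWronskian_le hS
  have hflux := (hS.stationary.tendsto_frontFlux_atBot hS.balanced).abs.const_mul K
  rw [abs_zero, mul_zero] at hflux
  exact squeeze_zero_norm' ((eventually_le_atBot x₀).mono hK) hflux

theorem tendsto_fluxWronskian_edge : Tendsto (fluxWronskian D f φ W) (𝓝[≤] x₀) (𝓝 0) := by
  obtain ⟨K, hK⟩ := h.exists_norm_fluxWronskian_le hS
  have hflux := ((hS.stationary.continuous_frontFlux.tendsto x₀).abs.const_mul K).mono_left
    (nhdsWithin_le_nhds (s := Iic x₀))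
  rw [hS.frontFlux_edge, abs_zero, mul_zero] at hflux
  exact squeeze_zero_norm' (eventually_mem_nhdsWithin.mono hK) hflux

theorem fluxWronskian_edge : fluxWronskian D f φ W x₀ = 0 := by
  rw [fluxWronskian, hS.frontFlux_edge, h.edge, Complex.ofReal_zero, zero_mul, mul_zero, add_zero]

theorem integrableOn_deriv_mul : IntegrableOn (fun x => ((deriv φ x : ℝ) : ℂ) * W x) (Iic x₀) := by
  obtain ⟨K, hK⟩ := h.bounded
  exact hS.stationary.integrable_deriv.ofReal.integrableOn.mul_bdd (c := K)
    h.differentiable.continuous.aestronglyMeasurable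
    ((ae_restrict_mem measurableSet_Iic).mono fun x hx => (hK x hx).1)

theorem integral_forcing :
    z * ∫ x in Iic x₀, ((deriv φ x : ℝ) : ℂ) * W x =
      -c * (∫ x in Iic x₀, deriv φ x * frontFlux D φ x : ℝ) := by
  have hW := h.integrableOn_deriv_mul hS
  have hp : IntegrableOn (fun x => ((deriv φ x * frontFlux D φ x : ℝ) : ℂ)) (Iic x₀) :=
    hS.integrable_deriv_mul_frontFlux.integrableOn.ofReal
  have hFTC := integral_Iic_of_hasDerivAt_of_tendsto
    (f' := fun x => z * (((deriv φ x : ℝ) : ℂ) * W x) +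
      c * ((deriv φ x * frontFlux D φ x : ℝ) : ℂ)) (m := 0)
    (by simpa only [ContinuousWithinAt, h.fluxWronskian_edge hS]
      using h.tendsto_fluxWronskian_edge hS)
    (fun x hx => (h.hasDerivAt_fluxWronskian hS hx).congr_deriv (by push_cast; ring))
    ((hW.const_mul z).add (hp.const_mul c)) (h.tendsto_fluxWronskian_atBot hS)
  rw [integral_add (hW.const_mul z) (hp.const_mul c), integral_const_mul, integral_const_mul,
    integral_complex_ofReal, h.fluxWronskian_edge hS, sub_zero] at hFTC
  linear_combination hFTC

omit h in
theorem forcing_eq_zero (h : IsEdgeSolution D f φ x₀ 0 c W) : c = 0 := by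
  have hint := h.integral_forcing hS
  rw [zero_mul, eq_comm, mul_eq_zero, neg_eq_zero] at hint
  exact hint.resolve_right (Complex.ofReal_ne_zero.2 hS.integral_deriv_mul_frontFlux_pos.ne')

theorem hasDerivAt_div_frontFlux (hx : x < x₀) :
    HasDerivAt (fun y => W y / (frontFlux D φ y : ℂ))
      (fluxWronskian D f φ W x / (frontFlux D φ x : ℂ) ^ 2) x := by
  refine ((h.hasDerivAt x).div (hS.stationary.hasDerivAt_frontFlux x).ofReal_comp
    (Complex.ofReal_ne_zero.2 (hS.frontFlux_neg hx).ne)).congr_deriv ?_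
  rw [fluxWronskian]
  push_cast
  ring

omit h in
theorem exists_eq_mul_frontFlux (h : IsEdgeSolution D f φ x₀ 0 0 W) :
    ∃ k : ℂ, ∀ x < x₀, W x = k * (frontFlux D φ x : ℂ) := by
  have hconst : ∀ x < x₀, ∀ y < x₀, fluxWronskian D f φ W y = fluxWronskian D f φ W x :=
    fun x hx y hy => eq_of_deriv_eq_zero_of_lt (fun t ht => (h.hasDerivAt_fluxWronskian hS
      ht).congr_deriv (by rw [zero_mul, zero_mul, add_zero, mul_zero])) hy hx
  have hzero : ∀ x < x₀, fluxWronskian D f φ W x = 0 := fun x hx =>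
    tendsto_nhds_unique (tendsto_const_nhds.congr' ((eventually_lt_atBot x₀).mono
      fun y hy => (hconst x hx y hy).symm)) (h.tendsto_fluxWronskian_atBot hS)
  refine ⟨W (x₀ - 1) / (frontFlux D φ (x₀ - 1) : ℂ), fun x hx => ?_⟩
  rw [← div_eq_iff (Complex.ofReal_ne_zero.2 (hS.frontFlux_neg hx).ne)]
  exact eq_of_deriv_eq_zero_of_lt (q := fun y => W y / (frontFlux D φ y : ℂ))
    (fun t ht => (h.hasDerivAt_div_frontFlux hS ht).congr_deriv (by rw [hzero t ht, zero_div]))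
    hx (sub_one_lt x₀)

omit h in
theorem hasDerivAt_boundaryForm (h : IsEdgeSolution D f φ x₀ z 0 W) (hx : x < x₀) :
    HasDerivAt (boundaryForm D f φ W)
      (((‖fluxWronskian D f φ W x‖ ^ 2 / frontFlux D φ x ^ 2 : ℝ) : ℂ) +
        z * ((‖W x‖ ^ 2 / D (φ x) : ℝ) : ℂ)) x := by
  have hp : (frontFlux D φ x : ℂ) ≠ 0 := Complex.ofReal_ne_zero.2 (hS.frontFlux_neg hx).ne
  have hD : (D (φ x) : ℂ) ≠ 0 := Complex.ofReal_ne_zero.2 (hS.diffusivity_pos hx).ne'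
  have hderiv : ((deriv φ x : ℝ) : ℂ) = (frontFlux D φ x : ℂ) / D (φ x) := by
    rw [eq_div_iff hD, frontFlux, Complex.ofReal_mul, mul_comm]
  have hconj : HasDerivAt (fun y => starRingEnd ℂ (W y / (frontFlux D φ y : ℂ)))
      (starRingEnd ℂ (fluxWronskian D f φ W x / (frontFlux D φ x : ℂ) ^ 2)) x :=
    Complex.conjCLE.toContinuousLinearMap.hasFDerivAt.comp_hasDerivAt x
      (h.hasDerivAt_div_frontFlux hS hx)
  refine (hconj.mul (h.hasDerivAt_fluxWronskian hS hx)).congr_deriv ?_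
  rw [hderiv, map_div₀, map_div₀, map_pow, Complex.conj_ofReal]
  push_cast
  rw [← Complex.conj_mul', ← Complex.conj_mul']
  field_simp
  ring

theorem exists_norm_boundaryForm_le : ∃ K, ∀ x < x₀, ‖boundaryForm D f φ W x‖ ≤ K * ‖W x‖ := by
  obtain ⟨K, hK⟩ := h.exists_norm_fluxWronskian_le hS
  refine ⟨K, fun x hx => ?_⟩
  rw [boundaryForm, norm_mul, RCLike.norm_conj, norm_div, Complex.norm_real, Real.norm_eq_abs,
    div_mul_eq_mul_div, div_le_iff₀ (abs_pos.2 (hS.frontFlux_neg hx).ne), mul_comm K, mul_assoc]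
  exact mul_le_mul_of_nonneg_left (hK x hx.le) (norm_nonneg _)

theorem tendsto_boundaryForm_atBot : Tendsto (boundaryForm D f φ W) atBot (𝓝 0) := by
  obtain ⟨K, hK⟩ := h.exists_norm_boundaryForm_le hS
  have hW := h.tendsto_atBot.norm.const_mul K
  rw [norm_zero, mul_zero] at hW
  exact squeeze_zero_norm' ((eventually_lt_atBot x₀).mono hK) hW

theorem tendsto_boundaryForm_edge : Tendsto (boundaryForm D f φ W) (𝓝[<] x₀) (𝓝 0) := by
  obtain ⟨K, hK⟩ := h.exists_norm_boundaryForm_le hS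
  have hW := ((h.differentiable.continuous.tendsto x₀).norm.const_mul K).mono_left
    (nhdsWithin_le_nhds (s := Iio x₀))
  rw [h.edge, norm_zero, mul_zero] at hW
  exact squeeze_zero_norm' (eventually_mem_nhdsWithin.mono hK) hW

omit h in
theorem eq_zero_of_re_pos (h : IsEdgeSolution D f φ x₀ z 0 W) (hz : 0 < z.re) (hx : x < x₀) :
    W x = 0 := by
  have hmass : ∀ y < x₀, 0 ≤ ‖W y‖ ^ 2 / D (φ y) := fun y hy =>
    div_nonneg (sq_nonneg _) (hS.diffusivity_pos hy).le
  have hre := re_deriv_eq_zero_of_nonneg_of_tendsto (fun y hy => h.hasDerivAt_boundaryForm hS hy)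
    (fun y hy => by
      rw [Complex.add_re, Complex.re_mul_ofReal, Complex.ofReal_re]
      exact add_nonneg (by positivity) (mul_nonneg hz.le (hmass y hy)))
    (h.tendsto_boundaryForm_atBot hS) (h.tendsto_boundaryForm_edge hS) hx
  rw [Complex.add_re, Complex.re_mul_ofReal, Complex.ofReal_re,
    add_eq_zero_iff_of_nonneg (by positivity) (mul_nonneg hz.le (hmass x hx))] at hre
  simpa [hz.ne', (hS.diffusivity_pos hx).ne'] using hre.2

omit h in
theorem eq_zero_of_im_ne_zero (h : IsEdgeSolution D f φ x₀ z 0 W) (hz : z.im ≠ 0) (hx : x < x₀) :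
    W x = 0 := by
  set b : ℂ := -(Complex.I * z.im)
  have hb : ∀ r s : ℝ, (b * ((r : ℂ) + z * (s : ℂ))).re = z.im ^ 2 * s := fun r s => by
    simp [b]
    ring
  have hre := re_deriv_eq_zero_of_nonneg_of_tendsto
    (fun y hy => (h.hasDerivAt_boundaryForm hS hy).const_mul b)
    (fun y hy => by
      rw [hb]
      exact mul_nonneg (sq_nonneg _) (div_nonneg (sq_nonneg _) (hS.diffusivity_pos hy).le))
    (by simpa only [mul_zero] using (h.tendsto_boundaryForm_atBot hS).const_mul b)
    (by simpa only [mul_zero] using (h.tendsto_boundaryForm_edge hS).const_mul b) hx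
  rw [hb] at hre
  simpa [hz, (hS.diffusivity_pos hx).ne'] using hre

end IsEdgeSolution

/-! ### The spectral gap -/

namespace IsSharpFront

variable {D f φ : ℝ → ℝ} {α x₀ x : ℝ} (hS : IsSharpFront D f φ α x₀)

include hS

theorem integral_deriv : ∫ x in Iic x₀, deriv φ x = -1 := by
  rw [integral_Iic_of_hasDerivAt_of_tendsto' (fun x _ => hS.stationary.hasDerivAt x)
    hS.stationary.integrable_deriv.integrableOn hS.stationary.tendsto_atBot,
    hS.eq_zero le_rfl, zero_sub]

theorem norm_integral_deriv_mul_le {g : ℝ → ℂ} {R : ℝ} (hg : ∀ x < x₀, ‖g x‖ ≤ R) :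
    ‖∫ x in Iic x₀, ((deriv φ x : ℝ) : ℂ) * g x‖ ≤ R := by
  calc ‖∫ x in Iic x₀, ((deriv φ x : ℝ) : ℂ) * g x‖ ≤ ∫ x in Iio x₀, -R * deriv φ x := by
        rw [integral_Iic_eq_integral_Iio]
        refine norm_integral_le_of_norm_le
          (hS.stationary.integrable_deriv.integrableOn.const_mul (-R))
          ((ae_restrict_mem measurableSet_Iio).mono fun x hx => ?_)
        rw [norm_mul, Complex.norm_real, Real.norm_of_nonpos (hS.stationary.deriv_nonpos x),
          neg_mul, neg_mul, neg_le_neg_iff, mul_comm R]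
        exact mul_le_mul_of_nonpos_left (hg x hx) (hS.stationary.deriv_nonpos x)
    _ = R := by
        rw [integral_const_mul, ← integral_Iic_eq_integral_Iio, hS.integral_deriv, neg_mul_neg,
          mul_one]

theorem exists_lt_eq : ∃ a < x₀, φ a = α := by
  obtain ⟨a, ha⟩ := hS.stationary.exists_eq hS.balanced.reaction.mem_Ioo
  exact ⟨a, (hS.pos_iff a).1 (ha ▸ hS.balanced.reaction.mem_Ioo.1), ha⟩

end IsSharpFront

namespace IsEdgeSolution

variable {D f φ : ℝ → ℝ} {α x₀ x y N R : ℝ} {z : ℂ} {W : ℝ → ℂ}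
  (h : IsEdgeSolution D f φ x₀ z 0 W) (hS : IsSharpFront D f φ α x₀)

include h hS

theorem norm_fluxWronskian_sub_le (hN : ∀ x < x₀, ‖W x‖ ≤ N) (hxy : x ≤ y) (hy : y < x₀) :
    ‖fluxWronskian D f φ W y - fluxWronskian D f φ W x‖ ≤ ‖z‖ * N * (φ x - φ y) := by
  have hle : ∀ t < x₀, ‖((deriv φ t : ℝ) : ℂ) * (z * W t + 0 * (frontFlux D φ t : ℂ))‖ ≤
      ‖z‖ * N * -deriv φ t := fun t ht => by
    rw [zero_mul, add_zero, norm_mul, norm_mul, Complex.norm_real,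
      Real.norm_of_nonpos (hS.stationary.deriv_nonpos t), mul_comm]
    have hφt := neg_nonneg.2 (hS.stationary.deriv_nonpos t)
    gcongr
    exact hN t ht
  calc ‖fluxWronskian D f φ W y - fluxWronskian D f φ W x‖
      ≤ ‖z‖ * N * -φ y - ‖z‖ * N * -φ x :=
        norm_sub_le_sub_of_norm_deriv_le (g := fun t => ‖z‖ * N * -φ t)
          (fun t ht => h.hasDerivAt_fluxWronskian hS ht)
          (fun t _ => (hS.stationary.hasDerivAt t).fun_neg.const_mul (‖z‖ * N)) hle hxy hy
    _ = ‖z‖ * N * (φ x - φ y) := by ring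

theorem norm_fluxWronskian_le_mul_one_sub (hN : ∀ x < x₀, ‖W x‖ ≤ N) (hx : x < x₀) :
    ‖fluxWronskian D f φ W x‖ ≤ ‖z‖ * N * (1 - φ x) := by
  have hω := ((h.tendsto_fluxWronskian_atBot hS).const_sub (fluxWronskian D f φ W x)).norm
  rw [sub_zero] at hω
  exact le_of_tendsto_of_tendsto hω
    ((hS.stationary.tendsto_atBot.sub_const (φ x)).const_mul (‖z‖ * N))
    ((eventually_le_atBot x).mono fun a ha => h.norm_fluxWronskian_sub_le hS hN ha hx)

theorem norm_fluxWronskian_le_mul (hN : ∀ x < x₀, ‖W x‖ ≤ N) (hx : x < x₀) :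
    ‖fluxWronskian D f φ W x‖ ≤ ‖z‖ * N * φ x := by
  have hω := (((h.tendsto_fluxWronskian_edge hS).mono_left
    (nhdsWithin_mono x₀ Iio_subset_Iic_self)).sub_const (fluxWronskian D f φ W x)).norm
  rw [zero_sub, norm_neg] at hω
  have hφ : Tendsto (fun y => ‖z‖ * N * (φ x - φ y)) (𝓝[<] x₀) (𝓝 (‖z‖ * N * (φ x - φ x₀))) :=
    (((hS.stationary.continuous.tendsto x₀).const_sub (φ x)).const_mul (‖z‖ * N)).mono_left
      nhdsWithin_le_nhds
  rw [hS.eq_zero le_rfl, sub_zero] at hφ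
  exact le_of_tendsto_of_tendsto hω hφ (eventually_of_mem (Ioo_mem_nhdsLT hx) fun y hy =>
    h.norm_fluxWronskian_sub_le hS hN hy.1.le hy.2)

theorem norm_fluxWronskian_le (hN : ∀ x < x₀, ‖W x‖ ≤ N) (hx : x < x₀) :
    ‖fluxWronskian D f φ W x‖ ≤ 2 * (‖z‖ * N) * (φ x * (1 - φ x)) := by
  have hright := h.norm_fluxWronskian_le_mul hS hN hx
  have hleft := h.norm_fluxWronskian_le_mul_one_sub hS hN hx
  obtain ⟨h0, h1⟩ := hS.mem_Ioo hx
  calc ‖fluxWronskian D f φ W x‖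
      = (1 - φ x) * ‖fluxWronskian D f φ W x‖ + φ x * ‖fluxWronskian D f φ W x‖ := by ring
    _ ≤ (1 - φ x) * (‖z‖ * N * φ x) + φ x * (‖z‖ * N * (1 - φ x)) := by
        have := sub_pos.2 h1
        gcongr
    _ = 2 * (‖z‖ * N) * (φ x * (1 - φ x)) := by ring

theorem norm_div_frontFlux_sub_le (hR : ∀ x < x₀, ‖fluxWronskian D f φ W x‖ ≤
      R * (frontPotential D f (φ x) / D (φ x) + (φ x - α) * f (φ x)))
    (hxy : x ≤ y) (hy : y < x₀) :
    ‖W y / (frontFlux D φ y : ℂ) - W x / (frontFlux D φ x : ℂ)‖ ≤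
      R * ((φ y - α) / frontFlux D φ y) - R * ((φ x - α) / frontFlux D φ x) := by
  refine norm_sub_le_sub_of_norm_deriv_le (fun t ht => h.hasDerivAt_div_frontFlux hS ht)
    (fun t ht => (hS.hasDerivAt_sub_div_frontFlux ht).const_mul R) (fun t ht => ?_) hxy hy
  rw [norm_div, norm_pow, Complex.norm_real, Real.norm_eq_abs, sq_abs, ← mul_div_assoc]
  exact div_le_div_of_nonneg_right (hR t ht) (sq_nonneg _)

theorem exists_norm_sub_mul_frontFlux_le (hR0 : 0 ≤ R)
    (hR : ∀ x < x₀, ‖fluxWronskian D f φ W x‖ ≤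
      R * (frontPotential D f (φ x) / D (φ x) + (φ x - α) * f (φ x))) :
    ∃ k : ℂ, ∀ x < x₀, ‖W x - k * (frontFlux D φ x : ℂ)‖ ≤ R := by
  obtain ⟨a, hax, ha⟩ := hS.exists_lt_eq
  refine ⟨W a / (frontFlux D φ a : ℂ), fun x hx => ?_⟩
  have hp := (hS.frontFlux_neg hx).ne
  have hquot : ‖W x / (frontFlux D φ x : ℂ) - W a / (frontFlux D φ a : ℂ)‖ ≤
      R * |(φ x - α) / frontFlux D φ x| := by
    rcases le_total a x with hle | hle
    · have hosc := h.norm_div_frontFlux_sub_le hS hR hle hx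
      rw [ha, sub_self, zero_div, mul_zero, sub_zero] at hosc
      exact hosc.trans (mul_le_mul_of_nonneg_left (le_abs_self _) hR0)
    · have hosc := h.norm_div_frontFlux_sub_le hS hR hle hax
      rw [ha, sub_self, zero_div, mul_zero, zero_sub, ← mul_neg, norm_sub_rev] at hosc
      exact hosc.trans (mul_le_mul_of_nonneg_left (neg_le_abs _) hR0)
  have hα : |φ x - α| ≤ 1 := by
    rw [abs_le]
    have := hS.mem_Ioo hx
    have := hS.balanced.reaction.mem_Ioo
    constructor <;> linarith [this.1, this.2, (hS.mem_Ioo hx).1, (hS.mem_Ioo hx).2]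
  calc ‖W x - W a / (frontFlux D φ a : ℂ) * (frontFlux D φ x : ℂ)‖
      = ‖W x / (frontFlux D φ x : ℂ) - W a / (frontFlux D φ a : ℂ)‖ * |frontFlux D φ x| := by
        rw [← Real.norm_eq_abs, ← Complex.norm_real, ← norm_mul, sub_mul,
          div_mul_cancel₀ _ (Complex.ofReal_ne_zero.2 hp)]
    _ ≤ R * |(φ x - α) / frontFlux D φ x| * |frontFlux D φ x| := by gcongr
    _ = R * |φ x - α| := by
        rw [mul_assoc, ← abs_mul, div_mul_cancel₀ _ hp]
    _ ≤ R := mul_le_of_le_one_right hR0 hα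

theorem norm_mul_integral_le (hz : z ≠ 0) {k : ℂ}
    (hR : ∀ x < x₀, ‖W x - k * (frontFlux D φ x : ℂ)‖ ≤ R) :
    ‖k‖ * ∫ x in Iic x₀, deriv φ x * frontFlux D φ x ≤ R := by
  have hW := h.integrableOn_deriv_mul hS
  have hp : IntegrableOn (fun x => ((deriv φ x * frontFlux D φ x : ℝ) : ℂ)) (Iic x₀) :=
    hS.integrable_deriv_mul_frontFlux.integrableOn.ofReal
  have hzero : ∫ x in Iic x₀, ((deriv φ x : ℝ) : ℂ) * W x = 0 := by
    have hint := h.integral_forcing hS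
    rw [neg_zero, zero_mul, mul_eq_zero] at hint
    exact hint.resolve_left hz
  have hproj : ∫ x in Iic x₀, ((deriv φ x : ℝ) : ℂ) * (W x - k * (frontFlux D φ x : ℂ)) =
      -(k * ((∫ x in Iic x₀, deriv φ x * frontFlux D φ x : ℝ) : ℂ)) := by
    rw [← zero_sub, ← hzero, ← integral_complex_ofReal, ← integral_const_mul,
      ← integral_sub hW (hp.const_mul k)]
    congr 1 with x
    push_cast
    ring
  have hle := hS.norm_integral_deriv_mul_le hR
  rwa [hproj, norm_neg, norm_mul, Complex.norm_real,
    Real.norm_of_nonneg hS.integral_deriv_mul_frontFlux_pos.le] at hle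

end IsEdgeSolution

namespace IsSharpFront

variable {D f φ : ℝ → ℝ} {α x₀ : ℝ} (hS : IsSharpFront D f φ α x₀)

include hS

theorem exists_norm_edgeSolution_le :
    ∃ M : ℝ, 0 < M ∧ ∀ (z : ℂ) (W : ℝ → ℂ) (N : ℝ), IsEdgeSolution D f φ x₀ z 0 W → z ≠ 0 →
      (∀ x < x₀, ‖W x‖ ≤ N) → ∀ x < x₀, ‖W x‖ ≤ ‖z‖ * M * N := by
  obtain ⟨κ, hκ, hcoer⟩ := hS.balanced.exists_mul_le_frontPotential_div_add
  obtain ⟨C, hC, hflux⟩ := hS.exists_abs_frontFlux_le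
  have hA := hS.integral_deriv_mul_frontFlux_pos
  set A := ∫ x in Iic x₀, deriv φ x * frontFlux D φ x
  refine ⟨2 / κ * (1 + C / A), by positivity, fun z W N h hz hN x hx => ?_⟩
  have hN0 : 0 ≤ N := (norm_nonneg _).trans (hN x hx)
  set R := 2 * (‖z‖ * N) / κ with hR
  have hω : ∀ y < x₀, ‖fluxWronskian D f φ W y‖ ≤
      R * (frontPotential D f (φ y) / D (φ y) + (φ y - α) * f (φ y)) := fun y hy =>
    calc ‖fluxWronskian D f φ W y‖ ≤ 2 * (‖z‖ * N) * (φ y * (1 - φ y)) :=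
          h.norm_fluxWronskian_le hS hN hy
      _ = R * (κ * (φ y * (1 - φ y))) := by
          rw [hR]
          field_simp
      _ ≤ _ := mul_le_mul_of_nonneg_left (hcoer _ (hS.mem_Ioo hy)) (by positivity)
  obtain ⟨k, hk⟩ := h.exists_norm_sub_mul_frontFlux_le hS (by positivity) hω
  have hkA : ‖k‖ ≤ R / A := (le_div_iff₀ hA).2 (h.norm_mul_integral_le hS hz hk)
  calc ‖W x‖ = ‖W x - k * (frontFlux D φ x : ℂ) + k * (frontFlux D φ x : ℂ)‖ := by
        rw [sub_add_cancel]
    _ ≤ R + R / A * C := by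
        refine (norm_add_le _ _).trans (add_le_add (hk x hx) ?_)
        rw [norm_mul, Complex.norm_real]
        exact mul_le_mul hkA (hflux x hx) (norm_nonneg _) (by positivity)
    _ = ‖z‖ * (2 / κ * (1 + C / A)) * N := by
        rw [hR]
        ring

theorem exists_gap : ∃ μ : ℝ, 0 < μ ∧ ∀ (z : ℂ) (W : ℝ → ℂ), IsEdgeSolution D f φ x₀ z 0 W →
    z ≠ 0 → ‖z‖ < μ → ∀ x < x₀, W x = 0 := by
  obtain ⟨M, hM, hle⟩ := hS.exists_norm_edgeSolution_le
  refine ⟨M⁻¹, inv_pos.2 hM, fun z W h hz hzM x hx => ?_⟩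
  obtain ⟨K, hK⟩ := h.bounded
  have hiter : ∀ n : ℕ, ∀ y < x₀, ‖W y‖ ≤ (‖z‖ * M) ^ n * K := by
    intro n
    induction n with
    | zero => exact fun y hy => by simpa using (hK y hy.le).1
    | succ n ih => exact fun y hy => (hle z W _ h hz ih y hy).trans_eq (by ring)
  rw [← one_div, lt_div_iff₀ hM] at hzM
  have hlim := (tendsto_pow_atTop_nhds_zero_of_lt_one (by positivity) hzM).mul_const K
  rw [zero_mul] at hlim
  exact norm_le_zero_iff.1 (ge_of_tendsto' hlim fun n => hiter n x hx)

end IsSharpFront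

/-! ### From the operator to the equation -/

theorem tendsto_zero_atBot_of_memLp_two {𝕜 : Type*} [RCLike 𝕜] {a : ℝ} {g g' : ℝ → 𝕜}
    (hderiv : ∀ x ≤ a, HasDerivAt g (g' x) x) (hg : MemLp g 2 (volume.restrict (Iic a)))
    (hg' : MemLp g' 2 (volume.restrict (Iic a))) : Tendsto g atBot (𝓝 0) := by
  have hsq := tendsto_zero_of_hasDerivAt_of_integrableOn_Iic (f := fun x => g x * g x)
    (fun x hx => (hderiv x hx).mul (hderiv x hx))
    ((hg'.integrable_mul hg).add (hg.integrable_mul hg')) (hg.integrable_mul hg)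
  have hnorm := hsq.norm.sqrt
  simp only [norm_mul, Real.sqrt_mul_self (norm_nonneg _), norm_zero, Real.sqrt_zero] at hnorm
  exact tendsto_zero_iff_norm_tendsto_zero.2 hnorm

theorem exists_norm_le_Iic_of_tendsto_zero {E : Type*} [NormedAddCommGroup E] {g : ℝ → E}
    (hg : Continuous g) (htendsto : Tendsto g atBot (𝓝 0)) (b : ℝ) : ∃ K, ∀ x ≤ b, ‖g x‖ ≤ K := by
  obtain ⟨a, ha⟩ := eventually_atBot.1
    ((tendsto_zero_iff_norm_tendsto_zero.1 htendsto).eventually (gt_mem_nhds one_pos))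
  obtain ⟨K, hK⟩ := isCompact_Icc.exists_bound_of_continuousOn (hg.continuousOn (s := Icc a b))
  exact ⟨max 1 K, fun x hx => (le_total x a).elim (fun h => (ha x h).le.trans (le_max_left _ _))
    fun h => (hK x ⟨h, hx⟩).trans (le_max_right _ _)⟩

theorem hasDerivAt_primitive_of_ae_eq {E : Type*} [NormedAddCommGroup E] [NormedSpace ℝ E]
    [CompleteSpace E] {v F : ℝ → E} {s : Set ℝ} {x : ℝ} (hv : LocallyIntegrable v volume)
    (hs : s ∈ 𝓝 x) (hvF : ∀ᵐ y, y ∈ s → v y = F y) (hF : ContinuousAt F x) :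
    HasDerivAt (fun y => ∫ t in (0 : ℝ)..y, v t) (F x) x := by
  classical
  have hae : v =ᵐ[volume] s.piecewise F v := hvF.mono fun y hy => by
    by_cases hys : y ∈ s
    · rw [piecewise_eq_of_mem _ _ _ hys, hy hys]
    · rw [piecewise_eq_of_notMem _ _ _ hys]
  have hV := (locallyIntegrable_congr hae).1 hv
  have hderiv := intervalIntegral.integral_hasDerivAt_right
    (intervalIntegrable_of_locallyIntegrable hV 0 x)
    hV.aestronglyMeasurable.stronglyMeasurableAtFilter
    (hF.congr (eventually_of_mem hs fun y hy => (piecewise_eq_of_mem _ _ _ hy).symm))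
  rw [piecewise_eq_of_mem _ _ _ (mem_of_mem_nhds hs)] at hderiv
  exact hderiv.congr_of_eventuallyEq (Eventually.of_forall fun y =>
    intervalIntegral.integral_congr_ae (hae.mono fun t ht _ => ht))

namespace IsSharpFront

variable {D f φ : ℝ → ℝ} {α x₀ x : ℝ} {z c : ℂ} {u v W : ℝ → ℂ} (hS : IsSharpFront D f φ α x₀)

include hS

theorem diffMul_eq_zero (hx : x₀ ≤ x) : diffMul D φ u x = 0 := by
  rw [diffMul, hS.eq_zero hx, hS.balanced.diffusivity.map_zero, Complex.ofReal_zero, zero_mul]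

theorem eq_zero_of_diffMul_ae_eq (hW : Continuous W) (huW : diffMul D φ u =ᵐ[volume] W)
    (hx : x₀ ≤ x) : W x = 0 := by
  have hae : W =ᵐ[volume.restrict (Ici x₀)] fun _ => 0 := by
    filter_upwards [ae_restrict_of_ae huW, ae_restrict_mem measurableSet_Ici] with y hy hy0
    rw [← hy, hS.diffMul_eq_zero hy0]
  exact Measure.eqOn_of_ae_eq hae hW.continuousOn continuousOn_const
    (by rw [interior_Ici, closure_Ioi]) hx

theorem continuousAt_deriv (hx : x < x₀) : ContinuousAt (deriv φ) x := by
  have hD := hS.stationary.continuous_comp hS.balanced.diffusivity.continuousOn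
  refine (hS.stationary.continuous_frontFlux.continuousAt.div hD.continuousAt
    (hS.diffusivity_pos hx).ne').congr (eventually_of_mem (Iio_mem_nhds hx) fun y hy => ?_)
  exact mul_div_cancel_left₀ _ (hS.diffusivity_pos hy).ne'

theorem continuousAt_edgeEquation (hW : Continuous W) (hx : x < x₀) :
    ContinuousAt (fun y => (z - (derivWithin f (Icc 0 1) (φ y) : ℝ)) * (W y / (D (φ y) : ℝ)) +
      c * (deriv φ y : ℝ)) x := by
  have hD := Complex.continuous_ofReal.comp
    (hS.stationary.continuous_comp hS.balanced.diffusivity.continuousOn)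
  have hf := Complex.continuous_ofReal.comp
    (hS.stationary.continuous_comp hS.balanced.reaction.continuousOn_derivWithin)
  exact ((continuousAt_const.sub hf.continuousAt).mul (hW.continuousAt.div hD.continuousAt
    (Complex.ofReal_ne_zero.2 (hS.diffusivity_pos hx).ne'))).add (continuousAt_const.mul
    (Complex.continuous_ofReal.continuousAt.comp (hS.continuousAt_deriv hx)))

theorem ae_eq_edgeEquation (huW : diffMul D φ u =ᵐ[volume] W)
    (hv : v =ᵐ[volume] fun x => z * u x + c * (deriv φ x : ℝ) - reactMul f φ u x) :
    ∀ᵐ x, x < x₀ → v x =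
      (z - (derivWithin f (Icc 0 1) (φ x) : ℝ)) * (W x / (D (φ x) : ℝ)) + c * (deriv φ x : ℝ) := by
  filter_upwards [hv, huW] with x hvx hWx hx
  rw [hvx, ← hWx, diffMul, reactMul,
    mul_div_cancel_left₀ _ (Complex.ofReal_ne_zero.2 (hS.diffusivity_pos hx).ne')]
  ring

theorem exists_isEdgeSolution (h : IsH2WithSecondDeriv (diffMul D φ u) v)
    (hv : v =ᵐ[volume] fun x => z * u x + c * (deriv φ x : ℝ) - reactMul f φ u x) :
    ∃ W, diffMul D φ u =ᵐ[volume] W ∧ IsEdgeSolution D f φ x₀ z c W ∧ ∀ x, x₀ ≤ x → W x = 0 := by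
  obtain ⟨W, W₁, k, huW, hderiv, hW₁, hWL, hW₁L⟩ := h.exists_representative
  obtain rfl : deriv W = W₁ := funext fun x => (hderiv x).deriv
  have hW : Differentiable ℝ W := fun x => (hderiv x).differentiableAt
  have hvloc := h.2.1.locallyIntegrable (by norm_num)
  have hW₁c : Continuous (deriv W) := by
    rw [funext hW₁]
    exact (continuous_primitive_of_locallyIntegrable hvloc).const_add k
  have hvW := hS.ae_eq_edgeEquation huW hv
  have hderiv₂ : ∀ x < x₀, HasDerivAt (deriv W)
      ((z - (derivWithin f (Icc 0 1) (φ x) : ℝ)) * (W x / (D (φ x) : ℝ)) + c * (deriv φ x : ℝ)) x :=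
    fun x hx => by
      rw [funext hW₁]
      exact (hasDerivAt_primitive_of_ae_eq hvloc (Iio_mem_nhds hx) hvW
        (hS.continuousAt_edgeEquation hW.continuous hx)).const_add k
  have hWbot : Tendsto W atBot (𝓝 0) := tendsto_zero_atBot_of_memLp_two (a := x₀)
    (fun x _ => hderiv x) (hWL.restrict _) (hW₁L.restrict _)
  have hW₁bot : Tendsto (deriv W) atBot (𝓝 0) := by
    refine tendsto_zero_atBot_of_memLp_two (a := x₀ - 1)
      (fun x hx => hderiv₂ x (hx.trans_lt (sub_one_lt x₀))) (hW₁L.restrict _)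
      ((memLp_congr_ae ?_).1 (h.2.1.restrict _))
    filter_upwards [ae_restrict_of_ae hvW, ae_restrict_mem measurableSet_Iic] with x hx hxa
    exact hx (lt_of_le_of_lt hxa (sub_one_lt x₀))
  obtain ⟨K, hK⟩ := exists_norm_le_Iic_of_tendsto_zero hW.continuous hWbot x₀
  obtain ⟨K', hK'⟩ := exists_norm_le_Iic_of_tendsto_zero hW₁c hW₁bot x₀
  have hzero : ∀ x, x₀ ≤ x → W x = 0 := fun x => hS.eq_zero_of_diffMul_ae_eq hW.continuous huW
  exact ⟨W, huW, ⟨hW, hderiv₂, hzero x₀ le_rfl, hWbot, max K K', fun x hx =>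
    ⟨(hK x hx).trans (le_max_left _ _), (hK' x hx).trans (le_max_right _ _)⟩⟩, hzero⟩

end IsSharpFront

/-! ### Eigenvalues of the linearized operator -/

section SimpleEigenvalue

variable {E : Type*} [AddCommGroup E] [Module ℂ E] {T : E →ₗ.[ℂ] E} {z : ℂ} {ψ : T.domain}

theorem shiftedMap_apply (u : T.domain) : shiftedMap T z u = T u - z • (u : E) :=
  rfl

theorem kerPow_le_span_singleton
    (hspan : ∀ (u : T.domain) (c : ℂ), shiftedMap T z u = c • (ψ : E) → (u : E) ∈ ℂ ∙ (ψ : E))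
    (n : ℕ) : kerPow T z n ≤ ℂ ∙ (ψ : E) := by
  induction n with
  | zero => exact bot_le
  | succ n ih =>
    rintro _ ⟨u, hu, rfl⟩
    obtain ⟨c, hc⟩ := Submodule.mem_span_singleton.1 (ih hu)
    exact hspan u c hc.symm

theorem isSimpleEigenvalue_of_mem_span_singleton (hne : ψ ≠ 0) (hψ : shiftedMap T z ψ = 0)
    (hspan : ∀ (u : T.domain) (c : ℂ), shiftedMap T z u = c • (ψ : E) → (u : E) ∈ ℂ ∙ (ψ : E)) :
    IsSimpleEigenvalue T z := by
  have hmem : (ψ : E) ∈ eigenspaceAt T z := ⟨ψ, hψ, rfl⟩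
  have hone : eigenspaceAt T z = kerPow T z 1 := rfl
  have hgeom : eigenspaceAt T z = ℂ ∙ (ψ : E) :=
    (hone.trans_le (kerPow_le_span_singleton hspan 1)).antisymm
      ((Submodule.span_singleton_le_iff_mem _ _).2 hmem)
  have halg : genEigenspaceAt T z = ℂ ∙ (ψ : E) :=
    (iSup_le (kerPow_le_span_singleton hspan)).antisymm
      ((Submodule.span_singleton_le_iff_mem _ _).2 (Submodule.mem_iSup_of_mem 1 (hone ▸ hmem)))
  have hψ0 : (ψ : E) ≠ 0 := fun h => hne (Subtype.ext h)
  refine ⟨fun hinj => hne (hinj (hψ.trans (map_zero _).symm)), ?_, ?_⟩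
  · rw [hgeom, finrank_span_singleton hψ0]
  · rw [halg, finrank_span_singleton hψ0]

end SimpleEigenvalue

namespace IsStationaryFront

variable {D f φ g : ℝ → ℝ} {α : ℝ} (hφ : IsStationaryFront D f φ) (hN : IsBalancedBistable D f α)

include hφ hN

theorem memLp_comp_mul_deriv (hg : ContinuousOn g (Icc 0 1)) :
    MemLp (fun x => ((g (φ x) * deriv φ x : ℝ) : ℂ)) 2 volume := by
  obtain ⟨C, hC⟩ := isCompact_Icc.exists_bound_of_continuousOn hg
  refine (hφ.memLp_deriv hN).of_le_mul (c := C) (Complex.measurable_ofReal.comp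
    ((hφ.continuous_comp hg).measurable.mul (measurable_deriv φ))).aestronglyMeasurable
    (ae_of_all _ fun x => ?_)
  rw [Complex.norm_real, Complex.norm_real, norm_mul]
  exact mul_le_mul_of_nonneg_right (hC _ (hφ.mem_Icc x)) (norm_nonneg _)

theorem memLp_reaction : MemLp (fun x => ((-f (φ x) : ℝ) : ℂ)) 2 volume := by
  obtain ⟨C, hC, hfC⟩ := hφ.exists_abs_reaction_le hN
  refine (hφ.memLp_deriv hN).of_le_mul (c := C) (Complex.continuous_ofReal.comp
    (hφ.continuous_comp hN.reaction.continuousOn).neg).aestronglyMeasurable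
    (ae_of_all _ fun x => ?_)
  rw [Complex.norm_real, Complex.norm_real, norm_neg]
  exact (hfC x).trans (mul_le_mul_of_nonneg_left
    (mul_le_of_le_one_left (abs_nonneg _) (Real.sqrt_le_one.2 (hφ.mem_Icc x).2)) hC.le)

theorem isH2WithSecondDeriv_frontFlux :
    IsH2WithSecondDeriv (fun x => (frontFlux D φ x : ℂ))
      (fun x => -((derivWithin f (Icc 0 1) (φ x) * deriv φ x : ℝ) : ℂ)) := by
  have hf := hφ.memLp_reaction hN
  have hf' := (hφ.memLp_comp_mul_deriv hN hN.reaction.continuousOn_derivWithin).neg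
  refine ⟨hφ.memLp_comp_mul_deriv hN hN.diffusivity.continuousOn, hf', _, hf,
    IsWeakDeriv.of_hasDerivAt (fun x => (hφ.hasDerivAt_frontFlux x).ofReal_comp)
      (hf.locallyIntegrable (by norm_num)),
    IsWeakDeriv.of_hasDerivAt (fun x => ?_) (hf'.locallyIntegrable (by norm_num))⟩
  have hderiv := hφ.hasDerivAt_comp (hN.reaction.contDiffOn.differentiableOn two_ne_zero _
    (hφ.mem_Icc x)).hasDerivWithinAt
  simpa only [Complex.ofReal_neg] using hderiv.fun_neg.ofReal_comp

end IsStationaryFront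

namespace IsSharpFront

variable {D f φ : ℝ → ℝ} {α x₀ : ℝ} (hS : IsSharpFront D f φ α x₀)

/-- The operator `𝓛` for a sharp front. -/
noncomputable abbrev linearization : L2 →ₗ.[ℂ] L2 :=
  linearizedOp hS.balanced.reaction hS.stationary

/-- The derivative `φ_x` of the front as an element of `L²(ℝ)`. It spans the kernel of `𝓛`, which
is the infinitesimal form of translation invariance. -/
noncomputable def translationMode : L2 :=
  (hS.stationary.memLp_deriv hS.balanced).toLp

theorem translationMode_ae_eq :
    hS.translationMode =ᵐ[volume] fun x => ((deriv φ x : ℝ) : ℂ) :=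
  MemLp.coeFn_toLp _

theorem diffMul_translationMode_ae_eq :
    diffMul D φ hS.translationMode =ᵐ[volume] fun x => (frontFlux D φ x : ℂ) :=
  hS.translationMode_ae_eq.mono fun x hx => by
    simp only [diffMul, hx, frontFlux, Complex.ofReal_mul]

theorem isH2WithSecondDeriv_translationMode :
    IsH2WithSecondDeriv (diffMul D φ hS.translationMode)
      (⇑(0 : L2) - reactMul f φ hS.translationMode) := by
  refine (hS.stationary.isH2WithSecondDeriv_frontFlux hS.balanced).congr
    hS.diffMul_translationMode_ae_eq.symm ?_
  filter_upwards [hS.translationMode_ae_eq, Lp.coeFn_zero ℂ 2 (volume : Measure ℝ)] with x hx h0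
  rw [Pi.sub_apply, h0, Pi.zero_apply, zero_sub, reactMul, hx, Complex.ofReal_mul]

theorem translationMode_mem_domain : hS.translationMode ∈ hS.linearization.domain :=
  ⟨_, hS.isH2WithSecondDeriv_translationMode⟩

theorem linearization_translationMode :
    hS.linearization ⟨hS.translationMode, hS.translationMode_mem_domain⟩ = 0 :=
  (linearizedOp_eq_iff _ _ _ _).2 hS.isH2WithSecondDeriv_translationMode

theorem translationMode_ne_zero : hS.translationMode ≠ 0 := by
  intro h0
  have hae : (fun x => (frontFlux D φ x : ℂ)) =ᵐ[volume] fun _ => 0 := by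
    filter_upwards [hS.diffMul_translationMode_ae_eq, Lp.coeFn_zero ℂ 2 (volume : Measure ℝ)]
      with x hx hzero
    rw [← hx, h0, diffMul, hzero, Pi.zero_apply, mul_zero]
  have heq := Measure.eq_of_ae_eq hae
    (Complex.continuous_ofReal.comp hS.stationary.continuous_frontFlux) continuous_const
  exact (hS.frontFlux_neg (sub_one_lt x₀)).ne (Complex.ofReal_eq_zero.1 (congrFun heq (x₀ - 1)))

variable {hS} {z c : ℂ} {u : hS.linearization.domain}

theorem exists_isEdgeSolution_of_shiftedMap_eq
    (hu : shiftedMap hS.linearization z u = c • hS.translationMode) :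
    ∃ W, diffMul D φ u.1 =ᵐ[volume] W ∧ IsEdgeSolution D f φ x₀ z c W ∧
      ∀ x, x₀ ≤ x → W x = 0 := by
  rw [shiftedMap_apply, sub_eq_iff_eq_add'] at hu
  refine hS.exists_isEdgeSolution ((linearizedOp_eq_iff _ _ u _).1 hu) ?_
  filter_upwards [Lp.coeFn_add (z • (u : L2)) (c • hS.translationMode), Lp.coeFn_smul z (u : L2),
    Lp.coeFn_smul c hS.translationMode, hS.translationMode_ae_eq] with x hadd hzu hcψ hψ
  rw [Pi.sub_apply, hadd, Pi.add_apply, hzu, hcψ, Pi.smul_apply, Pi.smul_apply, hψ, smul_eq_mul,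
    smul_eq_mul]

-- Where `φ = 0` the equation degenerates to `(f'(0) - z) u = 0`.
theorem eq_zero_of_diffMul_ae_eq_zero (hz : z ≠ ((derivWithin f (Icc 0 1) 0 : ℝ) : ℂ))
    (hu : shiftedMap hS.linearization z u = 0) (h0 : diffMul D φ u.1 =ᵐ[volume] 0) : u = 0 := by
  rw [shiftedMap_apply, sub_eq_zero] at hu
  have hreact := (((linearizedOp_eq_iff _ _ u _).1 hu).congr h0 .rfl).unique
    isH2WithSecondDeriv_zero
  refine Subtype.ext (Lp.ext ?_)
  filter_upwards [h0, hreact, Lp.coeFn_smul z (u : L2), Lp.coeFn_zero ℂ 2 (volume : Measure ℝ)]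
    with x hdiff hx hzu hzero
  rw [Submodule.coe_zero, hzero, Pi.zero_apply]
  rcases (hS.stationary.mem_Icc x).1.eq_or_lt with h | h
  · rw [Pi.sub_apply, hzu, Pi.smul_apply, smul_eq_mul, reactMul, ← h, ← sub_mul,
      Pi.zero_apply] at hx
    exact (mul_eq_zero.1 hx).resolve_left (sub_ne_zero.2 hz)
  · exact (mul_eq_zero.1 hdiff).resolve_left (Complex.ofReal_ne_zero.2
      (hS.balanced.diffusivity.pos _ ⟨h, (hS.stationary.mem_Icc x).2⟩).ne')

theorem exists_diffMul_ae_eq_mul_frontFlux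
    (hu : shiftedMap hS.linearization 0 u = c • hS.translationMode) :
    c = 0 ∧ ∃ k : ℂ, diffMul D φ u.1 =ᵐ[volume] fun x => k * (frontFlux D φ x : ℂ) := by
  obtain ⟨W, huW, hW, hzero⟩ := exists_isEdgeSolution_of_shiftedMap_eq hu
  obtain rfl := hW.forcing_eq_zero hS
  obtain ⟨k, hk⟩ := hW.exists_eq_mul_frontFlux hS
  refine ⟨rfl, k, huW.trans (ae_of_all _ fun x => ?_)⟩
  rcases lt_or_ge x x₀ with hx | hx
  · exact hk x hx
  · simp only [hzero x hx, frontFlux, hS.deriv_eq_zero hx, mul_zero, Complex.ofReal_zero]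

theorem mem_span_translationMode
    (hu : shiftedMap hS.linearization 0 u = c • hS.translationMode) :
    (u : L2) ∈ ℂ ∙ hS.translationMode := by
  obtain ⟨rfl, k, hk⟩ := exists_diffMul_ae_eq_mul_frontFlux hu
  set ψ : hS.linearization.domain := ⟨hS.translationMode, hS.translationMode_mem_domain⟩
  have hψ : shiftedMap hS.linearization 0 ψ = 0 := by
    rw [shiftedMap_apply, hS.linearization_translationMode, zero_smul, sub_zero]
  have hf0 : (0 : ℂ) ≠ ((derivWithin f (Icc 0 1) 0 : ℝ) : ℂ) :=
    (Complex.ofReal_ne_zero.2 hS.balanced.reaction.deriv_zero_neg.ne).symm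
  have hdiff : diffMul D φ (u - k • ψ : hS.linearization.domain).1 =ᵐ[volume] 0 := by
    filter_upwards [hk, hS.diffMul_translationMode_ae_eq,
      Lp.coeFn_sub (u : L2) (k • hS.translationMode), Lp.coeFn_smul k hS.translationMode]
      with x hu hψ hsub hsmul
    calc (D (φ x) : ℂ) * ((u : L2) - k • hS.translationMode : L2) x
        = diffMul D φ u.1 x - k * diffMul D φ hS.translationMode x := by
          rw [hsub, Pi.sub_apply, hsmul, Pi.smul_apply, smul_eq_mul, diffMul, diffMul]
          ring
      _ = 0 := by rw [hu, hψ, sub_self]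
  have hzero : u - k • ψ = 0 := eq_zero_of_diffMul_ae_eq_zero hf0
    (by rw [map_sub, map_smul, hu, hψ, zero_smul, smul_zero, sub_zero]) hdiff
  exact Submodule.mem_span_singleton.2 ⟨k, congrArg Subtype.val (sub_eq_zero.1 hzero).symm⟩

theorem exists_isEdgeSolution_ne_zero (hz : z ∈ pointSpectrum hS.linearization)
    (hzf : z ≠ ((derivWithin f (Icc 0 1) 0 : ℝ) : ℂ)) :
    ∃ W, IsEdgeSolution D f φ x₀ z 0 W ∧ ∃ y < x₀, W y ≠ 0 := by
  obtain ⟨u, hu, hu0⟩ : ∃ u, shiftedMap hS.linearization z u = 0 ∧ u ≠ 0 := by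
    by_contra! hinj
    exact hz ((injective_iff_map_eq_zero _).2 hinj)
  obtain ⟨W, huW, hW, hzero⟩ := exists_isEdgeSolution_of_shiftedMap_eq (c := 0)
    (hu.trans (zero_smul _ _).symm)
  refine ⟨W, hW, ?_⟩
  by_contra! hvanish
  exact hu0 (eq_zero_of_diffMul_ae_eq_zero hzf hu (huW.trans (ae_of_all _ fun x =>
    (lt_or_ge x x₀).elim (hvanish x) (hzero x))))

variable (hS)

theorem isSimpleEigenvalue_zero : IsSimpleEigenvalue hS.linearization 0 :=
  isSimpleEigenvalue_of_mem_span_singleton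
    (ψ := ⟨hS.translationMode, hS.translationMode_mem_domain⟩)
    (fun h => hS.translationMode_ne_zero (congrArg Subtype.val h))
    (by rw [shiftedMap_apply, hS.linearization_translationMode, zero_smul, sub_zero])
    fun _ _ => mem_span_translationMode

theorem exists_pointSpectrum_subset :
    ∃ μ₀ : ℝ, 0 < μ₀ ∧
      pointSpectrum hS.linearization ⊆ ((↑) : ℝ → ℂ) '' Iic (-μ₀) ∪ {0} := by
  obtain ⟨μ, hμ, hgap⟩ := hS.exists_gap
  refine ⟨min μ (-derivWithin f (Icc 0 1) 0),
    lt_min hμ (neg_pos.2 hS.balanced.reaction.deriv_zero_neg), fun z hz => ?_⟩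
  rcases eq_or_ne z 0 with hz0 | hz0
  · exact Or.inr hz0
  left
  rcases eq_or_ne z ((derivWithin f (Icc 0 1) 0 : ℝ) : ℂ) with hzf | hzf
  · exact ⟨_, mem_Iic.2 (le_neg_of_le_neg (min_le_right _ _)), hzf.symm⟩
  obtain ⟨W, hW, y, hy, hWy⟩ := exists_isEdgeSolution_ne_zero hz hzf
  have hre : z.re ≤ 0 := not_lt.1 fun h => hWy (hW.eq_zero_of_re_pos hS h hy)
  have him : z.im = 0 := by
    by_contra h
    exact hWy (hW.eq_zero_of_im_ne_zero hS h hy)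
  have hnorm : μ ≤ ‖z‖ := not_lt.1 fun h => hWy (hgap z W hW hz0 h y hy)
  have hzre : ((z.re : ℝ) : ℂ) = z := Complex.ext rfl him.symm
  rw [← hzre, Complex.norm_real, Real.norm_of_nonpos hre] at hnorm
  exact ⟨z.re, le_neg_of_le_neg ((min_le_left _ _).trans hnorm), hzre⟩

end IsSharpFront

theorem theorem4p6 (D f φ : ℝ → ℝ) (α : ℝ) (hD : IsDegenerateDiffusivity D)
    (hf : IsBistable f α) (hDf : ∫ u in (0 : ℝ)..1, D u * f u = 0)
    (hφ : IsStationaryFront D f φ) :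
    (∃ μ₀ : ℝ, 0 < μ₀ ∧
      pointSpectrum (linearizedOp hf hφ) ⊆ ((↑) : ℝ → ℂ) '' Set.Iic (-μ₀) ∪ {0}) ∧
    IsSimpleEigenvalue (linearizedOp hf hφ) 0 ∧
    ∃ hx : MeasureTheory.MemLp (fun x => ((deriv φ x : ℝ) : ℂ)) 2 MeasureTheory.volume,
      hx.toLp ≠ 0 ∧
      ∃ hdom : hx.toLp ∈ (linearizedOp hf hφ).domain,
        linearizedOp hf hφ ⟨hx.toLp, hdom⟩ = 0 := by
  have hN : IsBalancedBistable D f α := ⟨hD, hf, hDf⟩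
  obtain ⟨x₀, hx₀⟩ := hφ.exists_edge hN
  have hS : IsSharpFront D f φ α x₀ := ⟨hN, hφ, hx₀⟩
  exact ⟨hS.exists_pointSpectrum_subset, hS.isSimpleEigenvalue_zero, hφ.memLp_deriv hN,
    hS.translationMode_ne_zero, hS.translationMode_mem_domain, hS.linearization_translationMode⟩
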